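/- Let $n\in\mathbb N$, let $\Phi\in C^2(\mathbb R^n,\mathbb R)$ satisfy $\int_{\mathbb R^n}e^{-\Phi(x)}\,dx=1$, and put $d\mu=e^{-\Phi(x)}\,dx$. For $k\ge 0$ let $H_k=L^2(\mathbb R^n,\mu,\wedge^k\mathbb C^n)$ be the Hilbert space of $k$-forms $f=\sum_{j_1<\dots<j_k}f_J\,dz^J$ with norm $\|f\|_\mu^2=\int\sum_J|f_J|^2\,d\mu$ and scalar product $(\cdot\,|\,\cdot)_\mu$. Let $d_k\colon H_k\to H_{k+1}$ be the exterior differential, taken in the sense of distributions, with maximal domain $D(d_k)=\{f\in H_k: df\in H_{k+1}\}$, and let $d_k^*$ be its Hilbert space adjoint. $D(T)$, $Z(T)$, $R(T)$ denote the domain, kernel and range of an operator $T$. Let $A_0=d_0^*d_0$ and, for $k>0$, $$A_k=d_k^*d_k+d_{k-1}d_{k-1}^*,\qquad D(A_k)=D(d_k^*d_k)\cap D(d_{k-1}d_{k-1}^*).$$ For $k>0$ put $X_k=\overline{R(d_{k-1})}$, $V_k=D(d_k)\cap D(d_{k-1}^*)$, $a_k(v,w)=(d_kv\,|\,d_kw)_\mu+(d_{k-1}^*v\,|\,d_{k-1}^*w)_\mu$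 and $\|v\|_{V_k}^2=\|v\|_\mu^2+a_k(v,v)$ for $v,w\in V_k$. For an operator $T$ in $H_k$ let $m(T)=\inf\{\operatorname{Re}(Tv\,|\,v)_\mu: v\in D(T),\ \|v\|_\mu=1\}\in[-\infty,+\infty]$, with $\inf\emptyset=+\infty$, and for a subspace $M$ let $T|_M$ be the restriction of $T$ to $D(T)\cap M$. **Theorem.** Let $k>0$ and consider the following conditions, where subscripts on $d=d_k$ and $d^*=d_{k-1}^*$ are suppressed. 1. $m(A_k)>0$; 2. the norms $a_k(\cdot,\cdot)^{1/2}$ and $\|\cdot\|_{V_k}$ are equivalent on $V_k$; 3. there is $c>0$ with $\|v\|_\mu^2\le c^2(\|d^*v\|_\mu^2+\|dv\|_\mu^2)$ for all $v\in D(d^*)\cap D(d)$; 4. there is $c>0$ with $\|v\|_\mu^2\le c^2(\|d^*v\|_\mu^2+\|dv\|_\mu^2)$ for all $v\in D(d^*)\cap Z(d)$; 5. there is $c>0$ with $\|v\|_\mu^2\le c^2(\|d^*v\|_\mu^2+\|dv\|_\mu^2)$ for all $v\in D(d^*)\cap X_k$; 6. there is $c>0$ with $\|v\|_\mu\le c\|d^*v\|_\mu$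 for all $v\in D(d^*)\cap X_k$; 7. the range $R(d_{k-1})$ is closed in $H_k$, i.e. $R(d_{k-1})=X_k$; 8. the range $R(A_{k-1}|_{Z(d_{k-1})^\perp})$ is closed in $H_{k-1}$; 9. the norms $\|d^*\cdot\|_\mu$ and $\|\cdot\|_{V_k}$ are equivalent on $V_k\cap X_k$; 10. $m(A_k|_{X_k})>0$. Then (1), (2) and (3) are equivalent; (3) implies (4), and (4) implies (5); and (5)–(10) are equivalent. Moreover $m(A_k)\ge c^{-2}$ for every constant $c$ that is admissible in (3), $m(A_k|_{X_k})\ge c^{-2}$ for every constant $c$ that is admissible in one of (3)–(6), and $$m(A_k)=\min\{\,m(A_k|_{X_k}),\ m(A_k|_{X_k^\perp})\,\}.$$ Finally, (4) is equivalent to exactness, $Z(d_k)=R(d_{k-1})$, so that $Z(d_k)=R(d_{k-1})$ holds under any of (1)–(4). -/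

import Mathlib

open MeasureTheory
open scoped ContDiff

noncomputable section

namespace WeightedForms

/-! ### Operations on unbounded operators -/

section Operators

variable {E F G : Type*} [NormedAddCommGroup E] [InnerProductSpace ℂ E]
  [NormedAddCommGroup F] [InnerProductSpace ℂ F] [NormedAddCommGroup G] [InnerProductSpace ℂ G]

/-- The composition `g f` of unbounded operators, on its natural domain
`{x ∈ D(f) : f x ∈ D(g)}`. -/
def pcomp (g : F →ₗ.[ℂ] G) (f : E →ₗ.[ℂ] F) : E →ₗ.[ℂ] G where
  domain := (g.domain.comap f.toFun).map f.domain.subtype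
  toFun := g.toFun ∘ₗ
    ((f.toFun ∘ₗ Submodule.inclusion (Submodule.map_subtype_le _ _)).codRestrict g.domain (by
      rintro ⟨x, hx⟩
      obtain ⟨y, hy, rfl⟩ := hx
      exact hy))

/-- The kernel `Z(T)` as a subspace of the ambient space. -/
def pker (T : E →ₗ.[ℂ] F) : Submodule ℂ E := (LinearMap.ker T.toFun).map T.domain.subtype

/-- The range `R(T)`. -/
def prange (T : E →ₗ.[ℂ] F) : Submodule ℂ F := LinearMap.range T.toFun

/-- The lower bound `m(T) = inf {Re (T x | x) : x ∈ D(T), ‖x‖ = 1}`, as an extended real number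
(so that the infimum over the empty set is `+∞`). -/
def lowerBound (T : E →ₗ.[ℂ] E) : EReal :=
  ⨅ x : {x : T.domain // ‖(x : E)‖ = 1}, ((RCLike.re (inner ℂ (x.1 : E) (T x.1)) : ℝ) : EReal)

end Operators

/-! ### Differential forms with coefficients in a weighted `L²` space -/

/-- Increasing `k`-tuples `J = (j_1 < ... < j_k)` in `{1, ..., n}`. -/
abbrev Idx (n k : ℕ) : Type := Fin k ↪o Fin n

instance instFintypeIdx (n k : ℕ) : Fintype (Idx n k) := Fintype.ofFinite _

variable {n : ℕ}

/-- The measure `dμ = exp(-Φ) dx` on `ℝⁿ`. -/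
def weight (Φ : C(EuclideanSpace ℝ (Fin n), ℝ)) : Measure (EuclideanSpace ℝ (Fin n)) :=
  volume.withDensity fun x => ENNReal.ofReal (Real.exp (-Φ x))

/-- The Hilbert space `H_k = L²(ℝⁿ, μ, ⋀ᵏ ℂⁿ)`; a form `∑_J f_J dz^J` is given by its family of
coefficients `f_J`, with `‖f‖² = ∫ ∑_J |f_J|² dμ`. -/
abbrev FormSpace (Φ : C(EuclideanSpace ℝ (Fin n), ℝ)) (k : ℕ) : Type :=
  Lp (EuclideanSpace ℂ (Idx n k)) 2 (weight Φ)

/-- The tuple `K` of length `k + 1` with its `i`-th entry removed. -/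
def Idx.erase {k : ℕ} (K : Idx n (k + 1)) (i : Fin (k + 1)) : Idx n k :=
  (Fin.succAboveOrderEmb i).trans K

/-- The partial derivative `∂_j φ`. -/
def partialDeriv (j : Fin n) (φ : EuclideanSpace ℝ (Fin n) → ℂ)
    (x : EuclideanSpace ℝ (Fin n)) : ℂ :=
  fderiv ℝ φ x (EuclideanSpace.single j 1)

/-- `df = g` in the sense of distributions on `ℝⁿ`. Since
`d (∑_J f_J dz^J) = ∑_J ∑_j ∂_j f_J dz^j ∧ dz^J`, the coefficient of `df` at
`K = (j_0 < ... < j_k)` is `∑_i (-1)^i ∂_{j_i} f_{K without j_i}`; it is tested against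
`φ ∈ C_0^∞(ℝⁿ)` with Lebesgue measure. -/
def HasWeakD {Φ : C(EuclideanSpace ℝ (Fin n), ℝ)} {k : ℕ}
    (f : FormSpace Φ k) (g : FormSpace Φ (k + 1)) : Prop :=
  ∀ (K : Idx n (k + 1)) (φ : EuclideanSpace ℝ (Fin n) → ℂ), ContDiff ℝ ∞ φ → HasCompactSupport φ →
    ∫ x, g x K * φ x =
      -∑ i : Fin (k + 1), (-1 : ℂ) ^ (i : ℕ) *
        ∫ x, f x (K.erase i) * partialDeriv (K i) φ x

section Helpers

variable {Φ : C(EuclideanSpace ℝ (Fin n), ℝ)} {k : ℕ}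

lemma measurable_density : Measurable fun x => ENNReal.ofReal (Real.exp (-Φ x)) := by
  fun_prop

lemma volume_ac_weight : (volume : Measure (EuclideanSpace ℝ (Fin n))) ≪ weight Φ :=
  withDensity_absolutelyContinuous' measurable_density.aemeasurable
    (Filter.Eventually.of_forall fun x => by simp [Real.exp_pos])

instance instIsFiniteMeasureOnCompactsWeight : IsFiniteMeasureOnCompacts (weight Φ) := by
  have : IsLocallyFiniteMeasure (weight Φ) :=
    IsLocallyFiniteMeasure.withDensity_ofReal (by fun_prop)
  infer_instance

lemma integrable_coeff_mul (f : FormSpace Φ k) (J : Idx n k)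
    {φ : EuclideanSpace ℝ (Fin n) → ℂ} (hφ : Continuous φ) (hc : HasCompactSupport φ) :
    Integrable (fun x => f x J * φ x) := by
  have hf : MemLp (fun x => f x J) 2 (weight Φ) :=
    (Lp.memLp f).continuousLinearMap_comp (EuclideanSpace.proj J : _ →L[ℂ] ℂ)
  have h2 : Continuous (fun x => (Real.exp (Φ x) : ℂ) * φ x) := by fun_prop
  have hs : HasCompactSupport (fun x => (Real.exp (Φ x) : ℂ) * φ x) := hc.mul_left
  have h3 : MemLp (fun x => (Real.exp (Φ x) : ℂ) * φ x) 2 (weight Φ) :=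
    h2.memLp_of_hasCompactSupport hs
  have h4 : Integrable (fun x => f x J * ((Real.exp (Φ x) : ℂ) * φ x)) (weight Φ) :=
    hf.integrable_mul h3
  replace h4 := (integrable_withDensity_iff_integrable_smul' measurable_density
    (Filter.Eventually.of_forall fun x => ENNReal.ofReal_lt_top)).1 h4
  refine h4.congr (Filter.Eventually.of_forall fun x => ?_)
  have : (Real.exp (-Φ x) : ℂ) * (Real.exp (Φ x) : ℂ) = 1 := by
    rw [← Complex.ofReal_mul, ← Real.exp_add]; simp
  simp only [ENNReal.toReal_ofReal (Real.exp_pos _).le, Complex.real_smul]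
  linear_combination (f x J * φ x) * this

lemma continuous_partialDeriv (j : Fin n) {φ : EuclideanSpace ℝ (Fin n) → ℂ}
    (hφ : ContDiff ℝ ∞ φ) : Continuous (partialDeriv j φ) :=
  (hφ.continuous_fderiv (by simp)).clm_apply continuous_const

lemma hasCompactSupport_partialDeriv (j : Fin n) {φ : EuclideanSpace ℝ (Fin n) → ℂ}
    (hc : HasCompactSupport φ) : HasCompactSupport (partialDeriv j φ) :=
  hc.fderiv_apply ℝ _

lemma coe_add_ae (f g : FormSpace Φ k) :
    ∀ᵐ x ∂(volume : Measure (EuclideanSpace ℝ (Fin n))), (f + g : FormSpace Φ k) x = f x + g x :=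
  volume_ac_weight.ae_le (Lp.coeFn_add f g)

lemma coe_smul_ae (c : ℂ) (f : FormSpace Φ k) :
    ∀ᵐ x ∂(volume : Measure (EuclideanSpace ℝ (Fin n))), (c • f : FormSpace Φ k) x = c • f x :=
  volume_ac_weight.ae_le (Lp.coeFn_smul c f)

lemma integral_add_mul (f g : FormSpace Φ k) (J : Idx n k)
    {φ : EuclideanSpace ℝ (Fin n) → ℂ} (hφ : Continuous φ) (hc : HasCompactSupport φ) :
    ∫ x, (f + g : FormSpace Φ k) x J * φ x = (∫ x, f x J * φ x) + ∫ x, g x J * φ x := by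
  rw [← integral_add (integrable_coeff_mul f J hφ hc) (integrable_coeff_mul g J hφ hc)]
  refine integral_congr_ae ?_
  filter_upwards [coe_add_ae f g] with x hx
  rw [hx, PiLp.add_apply, add_mul]

lemma integral_smul_mul (c : ℂ) (f : FormSpace Φ k) (J : Idx n k)
    (φ : EuclideanSpace ℝ (Fin n) → ℂ) :
    ∫ x, (c • f : FormSpace Φ k) x J * φ x = c * ∫ x, f x J * φ x := by
  rw [← integral_const_mul]
  refine integral_congr_ae ?_
  filter_upwards [coe_smul_ae c f] with x hx
  rw [hx, PiLp.smul_apply, smul_eq_mul, mul_assoc]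

lemma HasWeakD.add {f f' : FormSpace Φ k} {g g' : FormSpace Φ (k + 1)}
    (h : HasWeakD f g) (h' : HasWeakD f' g') : HasWeakD (f + f') (g + g') := by
  intro K φ hφ hc
  rw [integral_add_mul g g' K hφ.continuous hc, h K φ hφ hc, h' K φ hφ hc, ← neg_add,
    ← Finset.sum_add_distrib]
  congr 1
  refine Finset.sum_congr rfl fun i _ => ?_
  rw [integral_add_mul f f' _ (continuous_partialDeriv _ hφ) (hasCompactSupport_partialDeriv _ hc),
    mul_add]

lemma HasWeakD.smul (c : ℂ) {f : FormSpace Φ k} {g : FormSpace Φ (k + 1)}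
    (h : HasWeakD f g) : HasWeakD (c • f) (c • g) := by
  intro K φ hφ hc
  rw [integral_smul_mul, h K φ hφ hc, mul_neg, Finset.mul_sum]
  congr 1
  refine Finset.sum_congr rfl fun i _ => ?_
  rw [integral_smul_mul]
  ring

lemma hasWeakD_zero : HasWeakD (0 : FormSpace Φ k) (0 : FormSpace Φ (k + 1)) := by
  intro K φ _ _
  have key : ∀ (m : ℕ) (J : Idx n m) (ψ : EuclideanSpace ℝ (Fin n) → ℂ),
      ∫ x, (0 : FormSpace Φ m) x J * ψ x = 0 := by
    intro m J ψ
    simpa using integral_smul_mul (0 : ℂ) (0 : FormSpace Φ m) J ψ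
  rw [key]
  simp only [key, mul_zero, Finset.sum_const_zero, neg_zero]

/-- The distributional exterior derivative is unique. -/
lemma HasWeakD.eq_zero {g : FormSpace Φ (k + 1)} (h : HasWeakD (0 : FormSpace Φ k) g) : g = 0 := by
  have hz : ∀ (K : Idx n (k + 1)) (φ : EuclideanSpace ℝ (Fin n) → ℂ), ContDiff ℝ ∞ φ →
      HasCompactSupport φ → ∫ x, g x K * φ x = 0 := by
    intro K φ hφ hc
    have h0 : HasWeakD (0 : FormSpace Φ k) (0 : FormSpace Φ (k + 1)) := hasWeakD_zero
    rw [h K φ hφ hc, ← h0 K φ hφ hc]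
    simpa using integral_smul_mul (0 : ℂ) (0 : FormSpace Φ (k + 1)) K φ
  have hae : ∀ K : Idx n (k + 1), ∀ᵐ x ∂(volume : Measure (EuclideanSpace ℝ (Fin n))),
      g x K = 0 := by
    intro K
    refine ae_eq_zero_of_integral_contDiff_smul_eq_zero ?_ ?_
    · refine (locallyIntegrable_iff).2 fun S hS => ?_
      obtain ⟨ψ, hψ1, -, hψc, -⟩ := exists_continuous_one_zero_of_isCompact hS isClosed_empty
        (Set.disjoint_empty S)
      have hi := (integrable_coeff_mul g K
        (φ := fun x => ((ψ x : ℝ) : ℂ)) (by fun_prop)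
        (hψc.comp_left (g := fun r : ℝ => (r : ℂ)) (by simp))).integrableOn (s := S)
      refine hi.congr_fun (fun x hx => ?_) hS.measurableSet
      simp [hψ1 hx]
    · intro φ hφ hc
      have := hz K (fun x => (φ x : ℂ)) (Complex.ofRealCLM.contDiff.comp hφ)
        (hc.comp_left (g := fun r : ℝ => (r : ℂ)) (by simp))
      rw [← this]
      refine integral_congr_ae (Filter.Eventually.of_forall fun x => ?_)
      simp [mul_comm]
  have hall : ∀ᵐ x ∂(volume : Measure (EuclideanSpace ℝ (Fin n))), g x = 0 := by
    filter_upwards [ae_all_iff.2 hae] with x hx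
    ext K
    simpa using hx K
  rw [Lp.eq_zero_iff_ae_eq_zero]
  exact (withDensity_absolutelyContinuous _ _).ae_le hall

end Helpers

/-- The graph of the maximal realisation of the exterior differential on `k`-forms. -/
def dGraph (Φ : C(EuclideanSpace ℝ (Fin n), ℝ)) (k : ℕ) :
    Submodule ℂ (FormSpace Φ k × FormSpace Φ (k + 1)) where
  carrier := {p | HasWeakD p.1 p.2}
  add_mem' h h' := HasWeakD.add h h'
  zero_mem' := hasWeakD_zero
  smul_mem' c _ h := HasWeakD.smul c h

/-- The exterior differential `d_k : H_k → H_{k+1}` as an unbounded operator with its maximal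
domain `D(d_k) = {f ∈ H_k : df ∈ H_{k+1}}`, derivatives being taken in the sense of
distributions. -/
def d (Φ : C(EuclideanSpace ℝ (Fin n), ℝ)) (k : ℕ) : FormSpace Φ k →ₗ.[ℂ] FormSpace Φ (k + 1) :=
  (dGraph Φ k).toLinearPMap

/-- `(f, g)` is in the graph of `d_k` iff `df = g` in the sense of distributions. -/
lemma mem_graph_d {Φ : C(EuclideanSpace ℝ (Fin n), ℝ)} {k : ℕ}
    {f : FormSpace Φ k} {g : FormSpace Φ (k + 1)} : (f, g) ∈ (d Φ k).graph ↔ HasWeakD f g := by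
  rw [d, Submodule.toLinearPMap_graph_eq]
  · rfl
  · rintro ⟨f, g⟩ h (rfl : f = 0)
    exact HasWeakD.eq_zero h

/-- The Hilbert space adjoint `d_k^* : H_{k+1} → H_k` with respect to the scalar product of
`L²(μ)`. -/
def dStar (Φ : C(EuclideanSpace ℝ (Fin n), ℝ)) (k : ℕ) :
    FormSpace Φ (k + 1) →ₗ.[ℂ] FormSpace Φ k :=
  (d Φ k).adjoint

/-- The Hodge Laplacian `A_k = d_k^* d_k + d_{k-1} d_{k-1}^*` (with `d_{-1} = 0`), on the domain
`D(d_k^* d_k) ∩ D(d_{k-1} d_{k-1}^*)`. -/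
def A (Φ : C(EuclideanSpace ℝ (Fin n), ℝ)) : (k : ℕ) → FormSpace Φ k →ₗ.[ℂ] FormSpace Φ k
  | 0 => pcomp (dStar Φ 0) (d Φ 0)
  | k + 1 => pcomp (dStar Φ (k + 1)) (d Φ (k + 1)) + pcomp (d Φ k) (dStar Φ k)

/-- `X_{k+1}`, the closure of the range of `d_k` in `H_{k+1}`. -/
def X (Φ : C(EuclideanSpace ℝ (Fin n), ℝ)) (k : ℕ) : Submodule ℂ (FormSpace Φ (k + 1)) :=
  (prange (d Φ k)).topologicalClosure

/-- `V_{k+1} = D(d_{k+1}) ∩ D(d_k^*)`, the form domain in degree `k + 1`. -/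
def V (Φ : C(EuclideanSpace ℝ (Fin n), ℝ)) (k : ℕ) : Submodule ℂ (FormSpace Φ (k + 1)) :=
  (d Φ (k + 1)).domain ⊓ (dStar Φ k).domain

variable {Φ : C(EuclideanSpace ℝ (Fin n), ℝ)} {k : ℕ}

/-- `d_{k+1} v` for `v ∈ V_{k+1}`. -/
def formD (v : V Φ k) : FormSpace Φ (k + 2) := d Φ (k + 1) ⟨v, v.2.1⟩

/-- `d_k^* v` for `v ∈ V_{k+1}`. -/
def formDStar (v : V Φ k) : FormSpace Φ k := dStar Φ k ⟨v, v.2.2⟩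

/-- The sesquilinear form `a(v, w) = (dv | dw) + (d^* v | d^* w)` on `V_{k+1}`, linear in `v`
(Mathlib's `inner` is linear in its second argument). -/
def form (v w : V Φ k) : ℂ := inner ℂ (formD w) (formD v) + inner ℂ (formDStar w) (formDStar v)

/-- `a(v, v)^{1/2}`. -/
def energyNorm (v : V Φ k) : ℝ := √(RCLike.re (form v v))

/-- The norm of `V_{k+1}`, given by `‖v‖² = ‖v‖_μ² + a(v, v)`. -/
def vNorm (v : V Φ k) : ℝ := √(‖(v : FormSpace Φ (k + 1))‖ ^ 2 + RCLike.re (form v v))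

/-- The Poincaré inequality `‖v‖² ≤ c² (‖d^* v‖² + ‖dv‖²)` for all forms
`v ∈ D(d_{k+1}) ∩ D(d_k^*)` of degree `k + 1` belonging to the subspace `S`. -/
def PoincareOn (S : Submodule ℂ (FormSpace Φ (k + 1))) (c : ℝ) : Prop :=
  ∀ v : V Φ k, (v : FormSpace Φ (k + 1)) ∈ S →
    ‖(v : FormSpace Φ (k + 1))‖ ^ 2 ≤ c ^ 2 * (‖formDStar v‖ ^ 2 + ‖formD v‖ ^ 2)

/-- The inequality `‖v‖ ≤ c ‖d_k^* v‖` for all `v ∈ D(d_k^*) ∩ X_{k+1}`. -/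
def DStarBound (Φ : C(EuclideanSpace ℝ (Fin n), ℝ)) (k : ℕ) (c : ℝ) : Prop :=
  ∀ v : (dStar Φ k).domain, (v : FormSpace Φ (k + 1)) ∈ X Φ k →
    ‖(v : FormSpace Φ (k + 1))‖ ≤ c * ‖dStar Φ k v‖

/-- Two functions `p, q` (norms) on a set `S` are equivalent. -/
def EquivalentOn {α : Type*} (S : Set α) (p q : α → ℝ) : Prop :=
  ∃ c C : ℝ, 0 < c ∧ 0 < C ∧ ∀ v ∈ S, c * q v ≤ p v ∧ p v ≤ C * q v

end WeightedForms

end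

noncomputable section

namespace WeightedForms

/-! ### Closed densely defined operators: adjoints, cores and closed ranges -/

section ClosedOperators

variable {E F G : Type*} [NormedAddCommGroup E] [InnerProductSpace ℂ E]
  [NormedAddCommGroup F] [InnerProductSpace ℂ F] [NormedAddCommGroup G] [InnerProductSpace ℂ G]

/-! Almost everything is Hilbert space theory for closed, densely defined operators `T : E → F` and
`S : F → G` with `R(T) ⊆ Z(S)`, applied to two consecutive exterior differentials. Let `X` be the
closure of `R(T)`. Then `X ⊆ Z(S)` and the orthogonal complement of `X` is `Z(T*)`, so in the
splitting `v = p + q` the form `‖T* v‖² + ‖S v‖²` decouples into `‖T* p‖² + ‖S q‖²`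
(`form_bound_iff`).

Lower bounds of the Laplacian and of its form agree because `D(B* B)` is a core for `B`
(`form_bound_of_core`), used with `B = T*` on `X` and `B = S` on the complement. This yields the
formula for `m` and carries Poincaré inequalities to lower bounds with the same constant.

A bound for `T*` on `X` means that `R(T)` is closed, equivalently `R(T* T)`
(`isClosed_prange_iff_bound_adjoint`, `isClosed_prange_iff_isClosed_prange_adjoint_comp`); these
rest on the open mapping and Hahn–Banach theorems. A bound on all of `Z(S)` also kills `Z(S) ∩
Z(T*)`, which is exactness (`pker_eq_prange_iff`).

What remains is that the differentials form such a complex: `isClosed_d`, `dense_domain_d`,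
`prange_d_le_pker_d`. Operators are handled through their graphs, which avoids carrying domain
proofs inside terms. -/

lemma mem_graph_pcomp {g : F →ₗ.[ℂ] G} {f : E →ₗ.[ℂ] F} {x : E} {z : G} :
    (x, z) ∈ (pcomp g f).graph ↔ ∃ y, (x, y) ∈ f.graph ∧ (y, z) ∈ g.graph := by
  simp only [LinearPMap.mem_graph_iff]
  constructor
  · rintro ⟨⟨_, u, hu, rfl⟩, rfl, rfl⟩
    exact ⟨f u, ⟨u, rfl, rfl⟩, ⟨f u, hu⟩, rfl, rfl⟩
  · rintro ⟨_, ⟨u, rfl, rfl⟩, ⟨w, hw⟩, h, rfl⟩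
    obtain rfl : w = f u := h
    exact ⟨⟨u, u, hw, rfl⟩, rfl, rfl⟩

lemma mem_graph_add {f g : E →ₗ.[ℂ] F} {x : E} {z : F} :
    (x, z) ∈ (f + g).graph ↔ ∃ y w, (x, y) ∈ f.graph ∧ (x, w) ∈ g.graph ∧ y + w = z := by
  simp only [LinearPMap.mem_graph_iff]
  constructor
  · rintro ⟨⟨u, hu⟩, rfl, rfl⟩
    exact ⟨_, _, ⟨⟨u, hu.1⟩, rfl, rfl⟩, ⟨⟨u, hu.2⟩, rfl, rfl⟩, rfl⟩
  · rintro ⟨_, _, ⟨⟨u, hu⟩, rfl, rfl⟩, ⟨⟨w, hw⟩, h, rfl⟩, rfl⟩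
    obtain rfl : w = u := h
    exact ⟨⟨w, hu, hw⟩, rfl, rfl⟩

lemma mem_graph_domRestrict {f : E →ₗ.[ℂ] F} {M : Submodule ℂ E} {x : E} {y : F} :
    (x, y) ∈ (f.domRestrict M).graph ↔ x ∈ M ∧ (x, y) ∈ f.graph := by
  simp only [LinearPMap.mem_graph_iff]
  constructor
  · rintro ⟨⟨u, hu⟩, rfl, rfl⟩
    exact ⟨hu.1, ⟨u, hu.2⟩, rfl, rfl⟩
  · rintro ⟨hM, ⟨u, hu⟩, rfl, rfl⟩
    exact ⟨⟨u, hM, hu⟩, rfl, rfl⟩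

lemma mem_pker {T : E →ₗ.[ℂ] F} {x : E} : x ∈ pker T ↔ (x, 0) ∈ T.graph := by
  simp only [LinearPMap.mem_graph_iff, pker, Submodule.mem_map, LinearMap.mem_ker]
  constructor
  · rintro ⟨u, hu, rfl⟩
    exact ⟨u, rfl, hu⟩
  · rintro ⟨u, rfl, hu⟩
    exact ⟨u, hu, rfl⟩

lemma mem_prange {T : E →ₗ.[ℂ] F} {y : F} : y ∈ prange T ↔ ∃ x, (x, y) ∈ T.graph := by
  simp only [LinearPMap.mem_graph_iff, prange, LinearMap.mem_range]
  constructor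
  · rintro ⟨u, rfl⟩
    exact ⟨u, u, rfl, rfl⟩
  · rintro ⟨_, u, rfl, rfl⟩
    exact ⟨u, rfl⟩

lemma graph_unique {T : E →ₗ.[ℂ] F} {x : E} {y z : F} (hy : (x, y) ∈ T.graph)
    (hz : (x, z) ∈ T.graph) : y = z :=
  T.mem_graph_snd_inj hy hz rfl

/-- Both sides of the inequality are homogeneous of degree two, so unit vectors suffice. Every later
comparison of lower bounds passes through this real inequality. -/
lemma coe_le_lowerBound {T : E →ₗ.[ℂ] E} {r : ℝ} :
    (r : EReal) ≤ lowerBound T ↔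
      ∀ x y, (x, y) ∈ T.graph → r * ‖x‖ ^ 2 ≤ RCLike.re (inner ℂ x y) := by
  simp only [lowerBound, le_iInf_iff, EReal.coe_le_coe_iff]
  constructor
  · intro h x y hxy
    obtain ⟨u, rfl, rfl⟩ := (LinearPMap.mem_graph_iff T).1 hxy
    by_cases hu : (u : E) = 0
    · simp [hu]
    have hn : ‖(u : E)‖ ≠ 0 := norm_ne_zero_iff.2 hu
    have := h ⟨((‖(u : E)‖⁻¹ : ℝ) : ℂ) • u, by simp [norm_smul, hn]⟩
    simp only [LinearPMap.map_smul, Submodule.coe_smul, inner_smul_left, inner_smul_right,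
      Complex.conj_ofReal, RCLike.re_to_complex, Complex.re_ofReal_mul] at this
    have h2 : (0 : ℝ) < ‖(u : E)‖ ^ 2 := by positivity
    rw [← mul_assoc, ← mul_inv, ← sq, ← div_eq_inv_mul, le_div_iff₀ h2] at this
    exact this
  · rintro h ⟨u, hu⟩
    simpa [hu] using h u (T u) (T.mem_graph u)

lemma eq_zero_of_inner_self_add_inner_self {x : E} {y : F}
    (h : inner ℂ x x + inner ℂ y y = 0) : x = 0 ∧ y = 0 := by
  have h' := congrArg RCLike.re h
  rw [map_add, inner_self_eq_norm_sq, inner_self_eq_norm_sq, map_zero] at h'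
  constructor <;> refine norm_eq_zero.1 (sq_eq_zero_iff.1 ?_) <;>
    linarith [sq_nonneg ‖x‖, sq_nonneg ‖y‖]

lemma isClosed_pker {T : E →ₗ.[ℂ] F} (hT : T.IsClosed) : IsClosed (pker T : Set E) := by
  have : (pker T : Set E) = (fun x : E => (x, (0 : F))) ⁻¹' (T.graph : Set (E × F)) := by
    ext x
    exact mem_pker
  rw [this]
  exact hT.preimage (by fun_prop)

/-- A closed subspace whose orthogonal complement is killed by `B` reduces `B`. -/
lemma graph_starProjection {B : E →ₗ.[ℂ] F} {M : Submodule ℂ E} [M.HasOrthogonalProjection]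
    (hM : Mᗮ ≤ pker B) {x : E} {y : F} (h : (x, y) ∈ B.graph) :
    (M.starProjection x, y) ∈ B.graph := by
  have := B.graph.sub_mem h (mem_pker.1 (hM (M.sub_starProjection_mem_orthogonal x)))
  simpa using this

variable [CompleteSpace E]

lemma mem_graph_adjoint {T : E →ₗ.[ℂ] F} (hd : Dense (T.domain : Set E)) {y : F} {z : E} :
    (y, z) ∈ T.adjoint.graph ↔ ∀ a b, (a, b) ∈ T.graph → inner ℂ b y = inner ℂ a z := by
  rw [LinearPMap.adjoint_graph_eq_graph_adjoint hd, Submodule.mem_adjoint_iff]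
  simp only [sub_eq_zero]

lemma inner_graph_adjoint {T : E →ₗ.[ℂ] F} (hd : Dense (T.domain : Set E)) {a : E} {b : F}
    {y : F} {z : E} (h : (a, b) ∈ T.graph) (h' : (y, z) ∈ T.adjoint.graph) :
    inner ℂ b y = inner ℂ a z :=
  (mem_graph_adjoint hd).1 h' a b h

lemma pker_adjoint {T : E →ₗ.[ℂ] F} (hd : Dense (T.domain : Set E)) :
    pker T.adjoint = (prange T)ᗮ := by
  ext y
  rw [mem_pker, mem_graph_adjoint hd, Submodule.mem_orthogonal]
  simp only [inner_zero_right, mem_prange]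
  exact ⟨fun h b ⟨a, hab⟩ => h a b hab, fun h a b hab => h b ⟨a, hab⟩⟩

lemma prange_adjoint_le {T : E →ₗ.[ℂ] F} (hd : Dense (T.domain : Set E)) :
    prange T.adjoint ≤ (pker T)ᗮ := by
  intro z hz
  obtain ⟨y, hyz⟩ := mem_prange.1 hz
  rw [Submodule.mem_orthogonal]
  intro x hx
  rw [← inner_graph_adjoint hd (mem_pker.1 hx) hyz, inner_zero_left]

variable [CompleteSpace F]

/-- The graphs of `T` and of `T*` (rotated) are orthogonal complements. -/
lemma exists_graph_decomposition {T : E →ₗ.[ℂ] F} (hd : Dense (T.domain : Set E))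
    (hc : T.IsClosed) (a : E) (b : F) :
    ∃ p p' r s, (p, p') ∈ T.graph ∧ (r, s) ∈ T.adjoint.graph ∧ a = p - s ∧ b = p' + r := by
  -- The plain product carries the sup norm; the `L²` product is a Hilbert space, where one can
  -- project onto the closed graph.
  let Γ : Submodule ℂ (WithLp 2 (E × F)) :=
    T.graph.comap (WithLp.linearEquiv 2 ℂ (E × F)).toLinearMap
  have hΓ : IsClosed (Γ : Set (WithLp 2 (E × F))) :=
    hc.preimage (WithLp.prod_continuous_ofLp 2 E F)
  have : CompleteSpace Γ := hΓ.completeSpace_coe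
  obtain ⟨p, hp, q, hq, h⟩ := Γ.exists_add_mem_mem_orthogonal (WithLp.toLp 2 (a, b))
  refine ⟨p.fst, p.snd, q.snd, -q.fst, hp, ?_, ?_, ?_⟩
  · rw [mem_graph_adjoint hd]
    intro x y hxy
    have := Γ.mem_orthogonal q |>.1 hq (WithLp.toLp 2 (x, y)) hxy
    rw [WithLp.prod_inner_apply] at this
    rw [inner_neg_right, eq_neg_iff_add_eq_zero, add_comm]
    exact this
  · simpa using congrArg WithLp.fst h
  · simpa using congrArg WithLp.snd h

/-- A closed densely defined operator is determined by its adjoint. -/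
lemma mem_graph_of_adjoint {T : E →ₗ.[ℂ] F} (hd : Dense (T.domain : Set E))
    (hc : T.IsClosed) {a : E} {b : F}
    (h : ∀ y z, (y, z) ∈ T.adjoint.graph → inner ℂ z a = inner ℂ y b) : (a, b) ∈ T.graph := by
  obtain ⟨p, p', r, s, hp, hr, rfl, rfl⟩ := exists_graph_decomposition hd hc a b
  -- Testing the hypothesis on the component `(r, s)` of the decomposition itself leaves `‖r‖² +
  -- ‖s‖² = 0`.
  have h1 := h r s hr
  have h2 : inner ℂ r p' = inner ℂ s p := by
    rw [← inner_conj_symm, inner_graph_adjoint hd hp hr, inner_conj_symm]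
  rw [inner_sub_right, inner_add_right, h2, sub_eq_iff_eq_add, add_assoc, left_eq_add] at h1
  obtain ⟨hr0, hs0⟩ := eq_zero_of_inner_self_add_inner_self h1
  simpa [hr0, hs0] using hp

/-- A vector `b` orthogonal to the domain of the adjoint would put `(0, b)` into the graph of `T`,
which is single-valued. -/
lemma dense_adjoint_domain {T : E →ₗ.[ℂ] F} (hd : Dense (T.domain : Set E))
    (hc : T.IsClosed) : Dense (T.adjoint.domain : Set F) := by
  rw [Submodule.dense_iff_topologicalClosure_eq_top, Submodule.topologicalClosure_eq_top_iff,
    Submodule.eq_bot_iff]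
  intro b hb
  have : ((0 : E), b) ∈ T.graph := by
    refine mem_graph_of_adjoint hd hc fun y z hyz => ?_
    rw [inner_zero_right]
    exact ((Submodule.mem_orthogonal _ _).1 hb y (LinearPMap.mem_domain_of_mem_graph hyz)).symm
  exact graph_unique this (T.graph.zero_mem)

lemma adjoint_adjoint {T : E →ₗ.[ℂ] F} (hd : Dense (T.domain : Set E))
    (hc : T.IsClosed) : T.adjoint.adjoint = T := by
  refine LinearPMap.eq_of_eq_graph (SetLike.ext ?_)
  rintro ⟨a, b⟩
  rw [mem_graph_adjoint (dense_adjoint_domain hd hc)]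
  refine ⟨fun h => mem_graph_of_adjoint hd hc h, fun h y z hyz => ?_⟩
  rw [← inner_conj_symm, ← inner_graph_adjoint hd h hyz, inner_conj_symm]

/-- von Neumann: `1 + T* T` is surjective. -/
lemma exists_add_adjoint_comp_self {T : E →ₗ.[ℂ] F} (hd : Dense (T.domain : Set E))
    (hc : T.IsClosed) (a : E) :
    ∃ p p' s, (p, p') ∈ T.graph ∧ (p', s) ∈ T.adjoint.graph ∧ a = p + s := by
  obtain ⟨p, p', r, s, hp, hr, rfl, h⟩ := exists_graph_decomposition hd hc a 0
  refine ⟨p, p', -s, hp, ?_, sub_eq_add_neg _ _⟩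
  rw [eq_neg_of_add_eq_zero_left h.symm]
  exact T.adjoint.graph.neg_mem hr

/-- `D(B* B)` is a core for `B`, so lower bounds for `B* B` on a reducing subspace pass to the
form domain. -/
lemma form_bound_of_core {B : E →ₗ.[ℂ] F} (hd : Dense (B.domain : Set E)) (hc : B.IsClosed)
    {M : Submodule ℂ E} [M.HasOrthogonalProjection] (hM : Mᗮ ≤ pker B) {r : ℝ}
    (h : ∀ u v w, (u, v) ∈ B.graph → (v, w) ∈ B.adjoint.graph → u ∈ M → r * ‖u‖ ^ 2 ≤ ‖v‖ ^ 2)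
    {u : E} {v : F} (huv : (u, v) ∈ B.graph) (hu : u ∈ M) : r * ‖u‖ ^ 2 ≤ ‖v‖ ^ 2 := by
  let Γ : Submodule ℂ (WithLp 2 (E × F)) :=
    B.graph.comap (WithLp.linearEquiv 2 ℂ (E × F)).toLinearMap
  have hΓ : IsClosed (Γ : Set (WithLp 2 (E × F))) :=
    hc.preimage (WithLp.prod_continuous_ofLp 2 E F)
  -- The part of the graph lying over `D(B* B)`; the aim is its density in `Γ`.
  let Γ₀ : Submodule ℂ (WithLp 2 (E × F)) :=
    Γ ⊓ B.adjoint.domain.comap (LinearMap.snd ℂ E F ∘ₗ (WithLp.linearEquiv 2 ℂ (E × F)).toLinearMap)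
  have hle : Γ₀.topologicalClosure ≤ Γ := Γ₀.topologicalClosure_minimal inf_le_left hΓ
  have hmem : WithLp.toLp 2 (u, v) ∈ Γ₀.topologicalClosure := by
    obtain ⟨k, hk, o, ho, hko⟩ :=
      Γ₀.topologicalClosure.exists_add_mem_mem_orthogonal (WithLp.toLp 2 (u, v))
    have hoΓ : o ∈ Γ := by
      have := Γ.sub_mem (show WithLp.toLp 2 (u, v) ∈ Γ from huv) (hle hk)
      rwa [hko, add_sub_cancel_left] at this
    rw [Submodule.orthogonal_closure] at ho
    -- Let `o = (x, B x)` be orthogonal to `Γ₀` and solve `p + B* B p = x`. Orthogonality to `(p, B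
    -- p)` then reads `(p + B* B p | x) = ‖x‖² = 0`.
    obtain ⟨p, p', s, hp, hs, h1⟩ := exists_add_adjoint_comp_self hd hc o.fst
    have h2 := (Γ₀.mem_orthogonal o).1 ho (WithLp.toLp 2 (p, p'))
      ⟨hp, LinearPMap.mem_domain_of_mem_graph hs⟩
    rw [WithLp.prod_inner_apply] at h2
    have h3 : inner ℂ p' o.snd = inner ℂ s o.fst := by
      rw [← inner_conj_symm, inner_graph_adjoint hd (show (o.fst, o.snd) ∈ B.graph from hoΓ) hs,
        inner_conj_symm]
    have h4 : inner ℂ o.fst o.fst = 0 := by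
      nth_rw 1 [h1]
      rw [inner_add_left, ← h3]
      exact h2
    have h5 : o.fst = 0 := inner_self_eq_zero.1 h4
    have h6 : o.snd = 0 := by
      refine graph_unique (T := B) (x := 0) ?_ B.graph.zero_mem
      rw [← h5]
      exact hoΓ
    have h7 : o = 0 := WithLp.ofLp_injective 2 (Prod.ext h5 h6)
    rwa [hko, h7, add_zero]
  -- Approximants from the core need not lie in `M`. Projecting the first component repairs this and
  -- leaves `B q` unchanged, since `B` vanishes on the complement of `M`.
  have hcl : IsClosed {q : WithLp 2 (E × F) | r * ‖M.starProjection q.fst‖ ^ 2 ≤ ‖q.snd‖ ^ 2} := by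
    have h1 : Continuous fun q : WithLp 2 (E × F) => q.fst :=
      continuous_fst.comp (WithLp.prod_continuous_ofLp 2 E F)
    have h2 : Continuous fun q : WithLp 2 (E × F) => q.snd :=
      continuous_snd.comp (WithLp.prod_continuous_ofLp 2 E F)
    exact isClosed_le (by fun_prop) (by fun_prop)
  have hsub : (Γ₀ : Set (WithLp 2 (E × F))) ⊆
      {q : WithLp 2 (E × F) | r * ‖M.starProjection q.fst‖ ^ 2 ≤ ‖q.snd‖ ^ 2} := by
    rintro q ⟨hq1, hq2⟩
    exact h _ _ _ (graph_starProjection hM hq1) (B.adjoint.mem_graph ⟨q.snd, hq2⟩)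
      (Submodule.starProjection_apply_mem _ _)
  have := closure_minimal hsub hcl hmem
  simpa [Submodule.starProjection_eq_self_iff.2 hu] using this

/-- Open mapping theorem for a closed operator with closed range. -/
lemma exists_bound_of_isClosed_prange {B : E →ₗ.[ℂ] F} (hc : B.IsClosed)
    (hr : IsClosed (prange B : Set F)) :
    ∃ c > 0, ∀ x y, (x, y) ∈ B.graph → x ∈ (pker B)ᗮ → ‖x‖ ≤ c * ‖y‖ := by
  have : CompleteSpace B.graph := hc.completeSpace_coe
  have : CompleteSpace (prange B) := hr.completeSpace_coe
  let f : B.graph →L[ℂ] prange B :=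
    ((ContinuousLinearMap.snd ℂ E F).comp B.graph.subtypeL).codRestrict (prange B)
      fun q => mem_prange.2 ⟨q.1.1, q.2⟩
  have hf : Function.Surjective f := by
    rintro ⟨y, hy⟩
    obtain ⟨x, hx⟩ := mem_prange.1 hy
    exact ⟨⟨(x, y), hx⟩, rfl⟩
  obtain ⟨C, hC, H⟩ := f.exists_preimage_norm_le hf
  refine ⟨C, hC, fun x y hxy hx => ?_⟩
  obtain ⟨⟨⟨x', y'⟩, hg⟩, h1, h2⟩ := H ⟨y, mem_prange.2 ⟨x, hxy⟩⟩
  obtain rfl : y' = y := congrArg Subtype.val h1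
  have hk : x' - x ∈ pker B := by
    rw [mem_pker]
    simpa using B.graph.sub_mem hg hxy
  -- Pythagoras: among all preimages of `y`, the one orthogonal to the kernel has minimal norm.
  have h3 : ‖x‖ ≤ ‖x'‖ := by
    have := norm_add_sq_eq_norm_sq_add_norm_sq_of_inner_eq_zero (𝕜 := ℂ) _ _
      ((Submodule.mem_orthogonal' _ _).1 hx _ hk)
    rw [add_sub_cancel] at this
    exact le_of_sq_le_sq (by nlinarith [sq_nonneg ‖x' - x‖]) (norm_nonneg _)
  exact h3.trans ((norm_fst_le (x', y')).trans h2)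

/-- Dual form of the closed range theorem: a lower bound for `B` off its kernel makes the range of
`B*` as large as possible. -/
lemma prange_adjoint_eq_of_bound {B : E →ₗ.[ℂ] F} (hd : Dense (B.domain : Set E))
    (hc : B.IsClosed) {c : ℝ}
    (h : ∀ x y, (x, y) ∈ B.graph → x ∈ (pker B)ᗮ → ‖x‖ ≤ c * ‖y‖) :
    prange B.adjoint = (pker B)ᗮ := by
  have hk : CompleteSpace (pker B) := (isClosed_pker hc).completeSpace_coe
  apply le_antisymm
  · exact prange_adjoint_le hd
  · intro y hy
    let D : Submodule ℂ B.domain := (pker B)ᗮ.comap B.domain.subtype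
    let g : D →ₗ[ℂ] F := B.toFun ∘ₗ D.subtype
    have hg : Function.Injective g := by
      rw [← LinearMap.ker_eq_bot, Submodule.eq_bot_iff]
      intro u hu
      have hu' : B u.1 = 0 := hu
      have := h u.1 0 (by rw [← hu']; exact B.mem_graph _) u.2
      rw [norm_zero, mul_zero, norm_le_zero_iff] at this
      exact Subtype.ext (Subtype.ext this)
    let e := LinearEquiv.ofInjective g hg
    -- The functional `B u ↦ (y | u)`, bounded by the assumed estimate. The Riesz vector of a
    -- Hahn–Banach extension is a preimage of `y` under `B*`.
    let φ : LinearMap.range g →ₗ[ℂ] ℂ :=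
      (innerₛₗ ℂ y) ∘ₗ B.domain.subtype ∘ₗ D.subtype ∘ₗ e.symm.toLinearMap
    have hφ : ∀ z, ‖φ z‖ ≤ (‖y‖ * c) * ‖z‖ := by
      intro z
      obtain ⟨u, rfl⟩ := e.surjective z
      have : φ (e u) = inner ℂ y ((u : B.domain) : E) := by simp [φ]
      rw [this, mul_assoc]
      refine (norm_inner_le_norm _ _).trans (mul_le_mul_of_nonneg_left ?_ (norm_nonneg _))
      exact h _ _ (B.mem_graph u.1) u.2
    obtain ⟨ψ, hψ, -⟩ := exists_extension_norm_eq (𝕜 := ℂ) _ (φ.mkContinuous _ hφ)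
    rw [mem_prange]
    refine ⟨(InnerProductSpace.toDual ℂ F).symm ψ, (mem_graph_adjoint hd).2 fun a b hab => ?_⟩
    rw [← inner_conj_symm, InnerProductSpace.toDual_symm_apply, ← inner_conj_symm a y]
    congr 1
    obtain ⟨k, hk', o, ho, rfl⟩ := (pker B).exists_add_mem_mem_orthogonal a
    have hob : (o, b) ∈ B.graph := by
      simpa using B.graph.sub_mem hab (mem_pker.1 hk')
    obtain ⟨u, rfl, rfl⟩ := (LinearPMap.mem_graph_iff B).1 hob
    have h1 := hψ (e ⟨u, ho⟩)
    have h2 : φ (e ⟨u, ho⟩) = inner ℂ y (u : E) := by simp [φ]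
    rw [LinearMap.mkContinuous_apply, h2] at h1
    rw [inner_add_right, (Submodule.mem_orthogonal' _ _).1 hy _ hk', zero_add]
    exact h1

/-- Closed range theorem for the product `T* T`. -/
lemma isClosed_prange_adjoint_comp_iff {T : E →ₗ.[ℂ] F} (hd : Dense (T.domain : Set E))
    (hc : T.IsClosed) :
    IsClosed (prange (pcomp T.adjoint T) : Set E) ↔ prange T.adjoint = (pker T)ᗮ := by
  have hk : CompleteSpace (pker T) := (isClosed_pker hc).completeSpace_coe
  have hle := prange_adjoint_le hd
  have hle2 : prange (pcomp T.adjoint T) ≤ prange T.adjoint := by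
    intro z hz
    obtain ⟨x, hx⟩ := mem_prange.1 hz
    obtain ⟨y, -, hy⟩ := mem_graph_pcomp.1 hx
    exact mem_prange.2 ⟨y, hy⟩
  constructor
  · intro hN
    refine le_antisymm hle fun y hy => hle2 ?_
    have : CompleteSpace (prange (pcomp T.adjoint T)) := hN.completeSpace_coe
    obtain ⟨z, hz, q, hq, rfl⟩ := (prange (pcomp T.adjoint T)).exists_add_mem_mem_orthogonal y
    have hqk : q ∈ (pker T)ᗮ := by
      simpa using (pker T)ᗮ.sub_mem hy (hle (hle2 hz))
    -- Write `q = p + T* T p`. Since `q` is orthogonal to `s = T* T p`, one gets `‖T p‖² + ‖s‖² =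
    -- 0`, so `q = p` lies in the kernel of `T` and in its complement.
    obtain ⟨p, p', s, hp, hs, rfl⟩ := exists_add_adjoint_comp_self hd hc q
    have hsN : s ∈ prange (pcomp T.adjoint T) :=
      mem_prange.2 ⟨p, mem_graph_pcomp.2 ⟨p', hp, hs⟩⟩
    have h1 := (Submodule.mem_orthogonal' _ _).1 hq s hsN
    rw [inner_add_left, ← inner_graph_adjoint hd hp hs] at h1
    obtain ⟨rfl, rfl⟩ := eq_zero_of_inner_self_add_inner_self h1
    rw [add_zero] at hqk ⊢
    have : inner ℂ p p = 0 := (Submodule.mem_orthogonal _ _).1 hqk p (mem_pker.2 hp)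
    rw [inner_self_eq_zero.1 this, add_zero]
    exact hz
  · intro hR
    suffices prange (pcomp T.adjoint T) = (pker T)ᗮ by
      rw [this]
      exact Submodule.isClosed_orthogonal _
    refine le_antisymm (hle2.trans hle) fun y hy => ?_
    rw [← hR] at hy
    have hTd := dense_adjoint_domain hd hc
    have hTc := LinearPMap.adjoint_isClosed hd
    obtain ⟨c, -, h⟩ := exists_bound_of_isClosed_prange hTc
      (by rw [hR]; exact Submodule.isClosed_orthogonal _)
    have hRT := prange_adjoint_eq_of_bound hTd hTc h
    rw [adjoint_adjoint hd hc] at hRT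
    obtain ⟨w, hw⟩ := mem_prange.1 hy
    have hk' : CompleteSpace (pker T.adjoint) := (isClosed_pker hTc).completeSpace_coe
    -- A preimage of `y` under `T*` may be projected off the kernel of `T*`; it then lies in `R(T)`,
    -- by `hRT`, which makes `y` a value of `T* T`.
    have hw' := graph_starProjection (M := (pker T.adjoint)ᗮ)
      (by rw [Submodule.orthogonal_orthogonal]) hw
    obtain ⟨x, hx⟩ := mem_prange.1
      (hRT.ge (Submodule.starProjection_apply_mem (pker T.adjoint)ᗮ w))
    exact mem_prange.2 ⟨x, mem_graph_pcomp.2 ⟨_, hx, hw'⟩⟩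

/-- **Closed range theorem**: the range of `T` is closed iff `T*` is bounded below off its
kernel. -/
lemma isClosed_prange_iff_bound_adjoint {T : E →ₗ.[ℂ] F} (hd : Dense (T.domain : Set E))
    (hc : T.IsClosed) :
    IsClosed (prange T : Set F) ↔ ∃ c > 0, ∀ v w, (v, w) ∈ T.adjoint.graph →
      v ∈ (prange T).topologicalClosure → ‖v‖ ≤ c * ‖w‖ := by
  have hTd := dense_adjoint_domain hd hc
  have hTc := LinearPMap.adjoint_isClosed hd
  have hX : (prange T).topologicalClosure = (pker T.adjoint)ᗮ := by
    rw [pker_adjoint hd, Submodule.orthogonal_orthogonal_eq_closure]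
  rw [hX]
  constructor
  · intro h
    obtain ⟨c, -, hb⟩ := exists_bound_of_isClosed_prange hc h
    refine exists_bound_of_isClosed_prange hTc ?_
    rw [prange_adjoint_eq_of_bound hd hc hb]
    exact Submodule.isClosed_orthogonal _
  · rintro ⟨c, -, h⟩
    have := prange_adjoint_eq_of_bound hTd hTc h
    rw [adjoint_adjoint hd hc] at this
    rw [this]
    exact Submodule.isClosed_orthogonal _

/-- The range of `T` is closed iff the range of `T* T` is. -/
lemma isClosed_prange_iff_isClosed_prange_adjoint_comp {T : E →ₗ.[ℂ] F}
    (hd : Dense (T.domain : Set E)) (hc : T.IsClosed) :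
    IsClosed (prange T : Set F) ↔ IsClosed (prange (pcomp T.adjoint T) : Set E) := by
  rw [isClosed_prange_adjoint_comp_iff hd hc]
  constructor
  · intro h
    obtain ⟨c, -, hb⟩ := exists_bound_of_isClosed_prange hc h
    exact prange_adjoint_eq_of_bound hd hc hb
  · intro h
    have hTc := LinearPMap.adjoint_isClosed hd
    obtain ⟨c, -, hb⟩ := exists_bound_of_isClosed_prange hTc
      (by rw [h]; exact Submodule.isClosed_orthogonal _)
    have := prange_adjoint_eq_of_bound (dense_adjoint_domain hd hc) hTc hb
    rw [adjoint_adjoint hd hc] at this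
    rw [this]
    exact Submodule.isClosed_orthogonal _

end ClosedOperators

/-! ### Hodge Laplacian of an abstract complex of closed operators -/

section Complexes

variable {E F G : Type*} [NormedAddCommGroup E] [InnerProductSpace ℂ E]
  [NormedAddCommGroup F] [InnerProductSpace ℂ F]
  [NormedAddCommGroup G] [InnerProductSpace ℂ G]
  {T : E →ₗ.[ℂ] F} {S : F →ₗ.[ℂ] G}

lemma topologicalClosure_prange_le_pker (hS : S.IsClosed) (hTS : prange T ≤ pker S) :
    (prange T).topologicalClosure ≤ pker S :=
  Submodule.topologicalClosure_minimal _ hTS (isClosed_pker hS)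

variable [CompleteSpace E]

lemma re_inner_adjoint_apply (hd : Dense (T.domain : Set E)) {a : E} {b : F} {z : E}
    (h : (a, b) ∈ T.graph) (h' : (b, z) ∈ T.adjoint.graph) :
    RCLike.re (inner ℂ a z) = ‖b‖ ^ 2 := by
  rw [← inner_graph_adjoint hd h h', inner_self_eq_norm_sq]

lemma re_inner_apply_adjoint (hd : Dense (T.domain : Set E)) {y : F} {a : E} {b : F}
    (h : (y, a) ∈ T.adjoint.graph) (h' : (a, b) ∈ T.graph) :
    RCLike.re (inner ℂ y b) = ‖a‖ ^ 2 := by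
  rw [← inner_conj_symm, RCLike.conj_re, inner_graph_adjoint hd h' h, inner_self_eq_norm_sq]

lemma orthogonal_topologicalClosure_prange_le_pker_adjoint (hd : Dense (T.domain : Set E)) :
    (prange T).topologicalClosureᗮ ≤ pker T.adjoint := by
  rw [Submodule.orthogonal_closure, pker_adjoint hd]

variable [CompleteSpace F]

/-- The Laplacian `S* S + T T*` of a complex `E → F → G`. -/
def hodge (T : E →ₗ.[ℂ] F) (S : F →ₗ.[ℂ] G) : F →ₗ.[ℂ] F :=
  pcomp S.adjoint S + pcomp T T.adjoint

lemma mem_graph_hodge {u z : F} :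
    (u, z) ∈ (hodge T S).graph ↔ ∃ t s w z', (u, t) ∈ S.graph ∧ (t, s) ∈ S.adjoint.graph ∧
      (u, w) ∈ T.adjoint.graph ∧ (w, z') ∈ T.graph ∧ s + z' = z := by
  simp only [hodge, mem_graph_add, mem_graph_pcomp]
  constructor
  · rintro ⟨s, z', ⟨t, h1, h2⟩, ⟨w, h3, h4⟩, rfl⟩
    exact ⟨t, s, w, z', h1, h2, h3, h4, rfl⟩
  · rintro ⟨t, s, w, z', h1, h2, h3, h4, rfl⟩
    exact ⟨s, z', ⟨t, h1, h2⟩, ⟨w, h3, h4⟩, rfl⟩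

/-- Lower bounds for the Laplacian on `X`, the closure of the range of `T`. -/
lemma coe_le_lowerBound_hodge_range
    (hTd : Dense (T.domain : Set E)) (hTc : T.IsClosed)
    (hSc : S.IsClosed) (hTS : prange T ≤ pker S) {r : ℝ} :
    (r : EReal) ≤ lowerBound ((hodge T S).domRestrict (prange T).topologicalClosure) ↔
      ∀ v w, (v, w) ∈ T.adjoint.graph → v ∈ (prange T).topologicalClosure →
        r * ‖v‖ ^ 2 ≤ ‖w‖ ^ 2 := by
  have hX := topologicalClosure_prange_le_pker hSc hTS
  simp only [coe_le_lowerBound, mem_graph_domRestrict, mem_graph_hodge]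
  constructor
  · intro h v w hvw hv
    -- Here `B = T*`, so `B* B = T T*`, which is the Laplacian on `X` because `S` vanishes there.
    refine form_bound_of_core (dense_adjoint_domain hTd hTc) (LinearPMap.adjoint_isClosed hTd)
      (orthogonal_topologicalClosure_prange_le_pker_adjoint hTd) ?_ hvw hv
    intro u w z huw hwz hu
    rw [adjoint_adjoint hTd hTc] at hwz
    rw [← re_inner_apply_adjoint hTd huw hwz]
    exact h u z ⟨hu, 0, 0, w, z, mem_pker.1 (hX hu), S.adjoint.graph.zero_mem, huw, hwz,
      zero_add z⟩
  · rintro h u _ ⟨hu, t, s, w, z, hut, hts, huw, hwz, rfl⟩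
    obtain rfl : t = 0 := graph_unique hut (mem_pker.1 (hX hu))
    obtain rfl : s = 0 := graph_unique hts S.adjoint.graph.zero_mem
    rw [zero_add, re_inner_apply_adjoint hTd huw hwz]
    exact h u w huw hu

/-- A coercivity estimate on the kernel of `S` is equivalent to exactness. -/
lemma pker_eq_prange_iff
    (hTd : Dense (T.domain : Set E)) (hTc : T.IsClosed)
    (hSc : S.IsClosed) (hTS : prange T ≤ pker S) :
    (∃ c > 0, ∀ v w, (v, w) ∈ T.adjoint.graph → v ∈ pker S → ‖v‖ ≤ c * ‖w‖) ↔
      pker S = prange T := by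
  constructor
  · rintro ⟨c, hc, h⟩
    have hX := topologicalClosure_prange_le_pker hSc hTS
    have hcl : IsClosed (prange T : Set F) :=
      (isClosed_prange_iff_bound_adjoint hTd hTc).2 ⟨c, hc, fun v w hvw hv => h v w hvw (hX hv)⟩
    refine le_antisymm (fun v hv => ?_) hTS
    obtain ⟨p, hp, q, hq, rfl⟩ :=
      (prange T).topologicalClosure.exists_add_mem_mem_orthogonal v
    -- The component of a closed `v` orthogonal to `X` is harmonic: both `S` and `T*` annihilate it,
    -- so the estimate forces it to vanish.
    have hq0 := h q 0 (mem_pker.1 (orthogonal_topologicalClosure_prange_le_pker_adjoint hTd hq))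
      (by simpa using (pker S).sub_mem hv (hX hp))
    rw [norm_zero, mul_zero, norm_le_zero_iff] at hq0
    rw [hcl.submodule_topologicalClosure_eq] at hp
    rwa [hq0, add_zero]
  · intro h
    have hcl : IsClosed (prange T : Set F) := h ▸ isClosed_pker hSc
    have := (isClosed_prange_iff_bound_adjoint hTd hTc).1 hcl
    rwa [hcl.submodule_topologicalClosure_eq, ← h] at this

variable [CompleteSpace G]

/-- Lower bounds for the Laplacian on the orthogonal complement of the range of `T`. -/
lemma coe_le_lowerBound_hodge_orthogonal
    (hTd : Dense (T.domain : Set E)) (hSd : Dense (S.domain : Set F))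
    (hSc : S.IsClosed) (hTS : prange T ≤ pker S) {r : ℝ} :
    (r : EReal) ≤ lowerBound ((hodge T S).domRestrict (prange T).topologicalClosureᗮ) ↔
      ∀ v t, (v, t) ∈ S.graph → v ∈ (prange T).topologicalClosureᗮ →
        r * ‖v‖ ^ 2 ≤ ‖t‖ ^ 2 := by
  have hX := topologicalClosure_prange_le_pker hSc hTS
  have hX' := orthogonal_topologicalClosure_prange_le_pker_adjoint hTd
  simp only [coe_le_lowerBound, mem_graph_domRestrict, mem_graph_hodge]
  constructor
  · intro h v t hvt hv
    refine form_bound_of_core hSd hSc (M := (prange T).topologicalClosureᗮ)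
      (by rwa [Submodule.orthogonal_orthogonal]) ?_ hvt hv
    intro u t s hut hts hu
    rw [← re_inner_adjoint_apply hSd hut hts]
    exact h u s ⟨hu, t, s, 0, 0, hut, hts, mem_pker.1 (hX' hu), T.graph.zero_mem, add_zero s⟩
  · rintro h u _ ⟨hu, t, s, w, z, hut, hts, huw, hwz, rfl⟩
    obtain rfl : w = 0 := graph_unique huw (mem_pker.1 (hX' hu))
    obtain rfl : z = 0 := graph_unique hwz T.graph.zero_mem
    rw [add_zero, re_inner_adjoint_apply hSd hut hts]
    exact h u t hut hu

/-- The form inequality on `D(S) ∩ D(T*)` splits along the decomposition of the middle space into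
the closure of the range of `T` and its orthogonal complement. -/
lemma form_bound_iff
    (hTd : Dense (T.domain : Set E)) (hTc : T.IsClosed)
    (hSd : Dense (S.domain : Set F)) (hSc : S.IsClosed) (hTS : prange T ≤ pker S) {r : ℝ} :
    (∀ v w t, (v, w) ∈ T.adjoint.graph → (v, t) ∈ S.graph →
        r * ‖v‖ ^ 2 ≤ ‖w‖ ^ 2 + ‖t‖ ^ 2) ↔
      (r : EReal) ≤ min (lowerBound ((hodge T S).domRestrict (prange T).topologicalClosure))
        (lowerBound ((hodge T S).domRestrict (prange T).topologicalClosureᗮ)) := by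
  have hX := topologicalClosure_prange_le_pker hSc hTS
  have hX' := orthogonal_topologicalClosure_prange_le_pker_adjoint hTd
  rw [le_min_iff, coe_le_lowerBound_hodge_range hTd hTc hSc hTS,
    coe_le_lowerBound_hodge_orthogonal hTd hSd hSc hTS]
  constructor
  · refine fun h => ⟨fun v w hvw hv => ?_, fun v t hvt hv => ?_⟩
    · simpa using h v w 0 hvw (mem_pker.1 (hX hv))
    · simpa using h v 0 t (mem_pker.1 (hX' hv)) hvt
  · rintro ⟨h1, h2⟩ v w t hvw hvt
    obtain ⟨p, hp, q, hq, rfl⟩ :=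
      (prange T).topologicalClosure.exists_add_mem_mem_orthogonal v
    -- As `q ∈ Z(T*)` and `p ∈ Z(S)`, both components stay in the relevant domains, with `T* p = T*
    -- v` and `S q = S v`.
    have h3 := h1 p w (by simpa using T.adjoint.graph.sub_mem hvw (mem_pker.1 (hX' hq))) hp
    have h4 := h2 q t (by simpa using S.graph.sub_mem hvt (mem_pker.1 (hX hp))) hq
    have h5 := norm_add_sq_eq_norm_sq_add_norm_sq_of_inner_eq_zero (𝕜 := ℂ) p q
      ((Submodule.mem_orthogonal _ _).1 hq p hp)
    rw [sq ‖p + q‖, h5]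
    linarith

/-- Restricting can only raise an infimum. Conversely, bounds on the two pieces combine to a form
bound, which on the domain of the Laplacian is an operator bound. -/
lemma lowerBound_hodge
    (hTd : Dense (T.domain : Set E)) (hTc : T.IsClosed)
    (hSd : Dense (S.domain : Set F)) (hSc : S.IsClosed) (hTS : prange T ≤ pker S) :
    lowerBound (hodge T S) =
      min (lowerBound ((hodge T S).domRestrict (prange T).topologicalClosure))
        (lowerBound ((hodge T S).domRestrict (prange T).topologicalClosureᗮ)) := by
  apply le_antisymm
  -- Comparing through the reals strictly below also covers infinite values.
  · refine EReal.ge_of_forall_gt_iff_ge.1 fun r hr => ?_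
    have h := coe_le_lowerBound.1 hr.le
    refine le_min ?_ ?_ <;> rw [coe_le_lowerBound] <;> intro x y hxy <;>
      exact h x y (mem_graph_domRestrict.1 hxy).2
  · refine EReal.ge_of_forall_gt_iff_ge.1 fun r hr => ?_
    have h := (form_bound_iff hTd hTc hSd hSc hTS).2 hr.le
    rw [coe_le_lowerBound]
    intro u z huz
    obtain ⟨t, s, w, z', hut, hts, huw, hwz, rfl⟩ := mem_graph_hodge.1 huz
    rw [inner_add_right, map_add, re_inner_adjoint_apply hSd hut hts,
      re_inner_apply_adjoint hTd huw hwz, add_comm]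
    exact h u w t huw hut

lemma coe_le_lowerBound_hodge
    (hTd : Dense (T.domain : Set E)) (hTc : T.IsClosed)
    (hSd : Dense (S.domain : Set F)) (hSc : S.IsClosed) (hTS : prange T ≤ pker S) {r : ℝ} :
    (r : EReal) ≤ lowerBound (hodge T S) ↔ ∀ v w t, (v, w) ∈ T.adjoint.graph →
      (v, t) ∈ S.graph → r * ‖v‖ ^ 2 ≤ ‖w‖ ^ 2 + ‖t‖ ^ 2 := by
  rw [lowerBound_hodge hTd hTc hSd hSc hTS, form_bound_iff hTd hTc hSd hSc hTS]

end Complexes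

/-! ### The weighted exterior differential: closed, densely defined, with square zero -/

section Differential

variable {n k : ℕ} {Φ : C(EuclideanSpace ℝ (Fin n), ℝ)}

lemma memLp_weight_of_hasCompactSupport {h : EuclideanSpace ℝ (Fin n) → EuclideanSpace ℂ (Idx n k)}
    (hh : Continuous h) (hc : HasCompactSupport h) : MemLp h 2 (weight Φ) :=
  hh.memLp_of_hasCompactSupport hc

lemma integral_toLp_mul {h : EuclideanSpace ℝ (Fin n) → EuclideanSpace ℂ (Idx n k)}
    (hh : MemLp h 2 (weight Φ)) (J : Idx n k) (ψ : EuclideanSpace ℝ (Fin n) → ℂ) :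
    ∫ x, (hh.toLp h : FormSpace Φ k) x J * ψ x = ∫ x, h x J * ψ x := by
  refine integral_congr_ae ?_
  filter_upwards [volume_ac_weight.ae_le hh.coeFn_toLp] with x hx
  rw [hx]

lemma integral_weight (g : EuclideanSpace ℝ (Fin n) → ℂ) :
    ∫ x, g x ∂(weight Φ) = ∫ x, (Real.exp (-Φ x) : ℂ) * g x := by
  rw [weight, integral_withDensity_eq_integral_toReal_smul measurable_density
    (Filter.Eventually.of_forall fun x => ENNReal.ofReal_lt_top)]
  refine integral_congr_ae (Filter.Eventually.of_forall fun x => ?_)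
  simp [ENNReal.toReal_ofReal (Real.exp_pos _).le]

/-- Testing a coefficient against a compactly supported continuous function is the scalar product
with a fixed form. -/
lemma exists_integral_coeff_mul_eq_inner (J : Idx n k) {ψ : EuclideanSpace ℝ (Fin n) → ℂ}
    (hψ : Continuous ψ) (hc : HasCompactSupport ψ) :
    ∃ u : FormSpace Φ k, ∀ f : FormSpace Φ k, ∫ x, f x J * ψ x = inner ℂ u f := by
  -- The factor `exp Φ` cancels the weight, and the conjugate undoes the antilinearity of the first
  -- slot of `inner`.
  let h : EuclideanSpace ℝ (Fin n) → EuclideanSpace ℂ (Idx n k) := fun x =>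
    starRingEnd ℂ ((Real.exp (Φ x) : ℂ) * ψ x) • EuclideanSpace.single J (1 : ℂ)
  have h1 : Continuous fun x => (Real.exp (Φ x) : ℂ) * ψ x := by fun_prop
  have hh : Continuous h := (Complex.continuous_conj.comp h1).smul continuous_const
  have h2 : HasCompactSupport fun x => (Real.exp (Φ x) : ℂ) * ψ x := hc.mul_left
  have hhc : HasCompactSupport h :=
    (h2.comp_left (g := starRingEnd ℂ) (map_zero _)).smul_right
  refine ⟨(memLp_weight_of_hasCompactSupport hh hhc).toLp h, fun f => ?_⟩
  rw [L2.inner_def, integral_weight]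
  refine integral_congr_ae ?_
  filter_upwards [volume_ac_weight.ae_le
    (memLp_weight_of_hasCompactSupport (Φ := Φ) hh hhc).coeFn_toLp] with x hx
  have : (Real.exp (-Φ x) : ℂ) * (Real.exp (Φ x) : ℂ) = 1 := by
    rw [← Complex.ofReal_mul, ← Real.exp_add]; simp
  rw [hx, inner_smul_left, EuclideanSpace.inner_single_left, Complex.conj_conj, map_one, one_mul]
  linear_combination (-(f x J * ψ x)) * this

lemma continuous_integral_coeff_mul (J : Idx n k) {ψ : EuclideanSpace ℝ (Fin n) → ℂ}
    (hψ : Continuous ψ) (hc : HasCompactSupport ψ) :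
    Continuous fun f : FormSpace Φ k => ∫ x, f x J * ψ x := by
  obtain ⟨u, hu⟩ := exists_integral_coeff_mul_eq_inner (Φ := Φ) J hψ hc
  simp only [hu]
  fun_prop

/-- For fixed test data the defining identity equates two continuous functions on the product of the
form spaces; the graph is the intersection of these closed conditions. -/
lemma isClosed_d (Φ : C(EuclideanSpace ℝ (Fin n), ℝ)) (k : ℕ) : (d Φ k).IsClosed := by
  have : ((d Φ k).graph : Set (FormSpace Φ k × FormSpace Φ (k + 1))) =
      {p | HasWeakD p.1 p.2} := by
    ext p
    exact mem_graph_d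
  rw [LinearPMap.IsClosed, this]
  simp only [HasWeakD, Set.ofPred_forall]
  refine isClosed_iInter fun K => isClosed_iInter fun φ => isClosed_iInter fun hφ =>
    isClosed_iInter fun hc => isClosed_eq ?_ ?_
  · exact (continuous_integral_coeff_mul K hφ.continuous hc).comp continuous_snd
  · refine (continuous_finsetSum _ fun i _ => continuous_const.mul ?_).neg
    exact (continuous_integral_coeff_mul _ (continuous_partialDeriv _ hφ)
      (hasCompactSupport_partialDeriv _ hc)).comp continuous_fst

lemma integral_partialDeriv_mul (j : Fin n) {φ ψ : EuclideanSpace ℝ (Fin n) → ℂ}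
    (hφ : ContDiff ℝ ∞ φ) (hψ : ContDiff ℝ ∞ ψ) (hcφ : HasCompactSupport φ)
    (hcψ : HasCompactSupport ψ) :
    ∫ x, partialDeriv j φ x * ψ x = -∫ x, φ x * partialDeriv j ψ x := by
  have h1 := hφ.continuous
  have h2 := hψ.continuous
  have h3 := continuous_partialDeriv j hφ
  have h4 := continuous_partialDeriv j hψ
  rw [eq_neg_iff_add_eq_zero, add_comm, ← eq_neg_iff_add_eq_zero]
  exact integral_mul_fderiv_eq_neg_fderiv_mul_of_integrable (v := EuclideanSpace.single j (1 : ℝ))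
    ((h3.mul h2).integrable_of_hasCompactSupport hcψ.mul_left)
    ((h1.mul h4).integrable_of_hasCompactSupport hcφ.mul_right)
    ((h1.mul h2).integrable_of_hasCompactSupport hcφ.mul_right)
    (fun x _ => (hφ.differentiable (by simp)).differentiableAt)
    (fun x _ => (hψ.differentiable (by simp)).differentiableAt)

/-- A monomial form `φ dz^J` with `φ ∈ C_0^∞` belongs to the domain of `d`. -/
lemma exists_hasWeakD_single (J : Idx n k) {φ : EuclideanSpace ℝ (Fin n) → ℂ}
    (hφ : ContDiff ℝ ∞ φ) (hc : HasCompactSupport φ)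
    (hm : MemLp (fun x => φ x • EuclideanSpace.single J (1 : ℂ)) 2 (weight Φ)) :
    ∃ g : FormSpace Φ (k + 1), HasWeakD (hm.toLp _ : FormSpace Φ k) g := by
  -- The classical `dφ ∧ dz^J`; the inner `single J` evaluated at `K.erase i` is the Kronecker
  -- symbol selecting those `K` that contain `J`.
  let h : EuclideanSpace ℝ (Fin n) → EuclideanSpace ℂ (Idx n (k + 1)) := fun x =>
    ∑ K : Idx n (k + 1), ∑ i : Fin (k + 1), partialDeriv (K i) φ x •
      EuclideanSpace.single K ((-1) ^ (i : ℕ) * (EuclideanSpace.single J (1 : ℂ)) (K.erase i))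
  have hh : Continuous h := by
    refine continuous_finsetSum _ fun K _ => continuous_finsetSum _ fun i _ => ?_
    exact (continuous_partialDeriv _ hφ).smul continuous_const
  have hhc : HasCompactSupport h := by
    refine HasCompactSupport.intro' hc.isCompact (isClosed_tsupport φ) fun x hx => ?_
    have : ∀ j, partialDeriv j φ x = 0 := fun j => by
      have := image_eq_zero_of_notMem_tsupport (f := fderiv ℝ φ)
        fun hx' => hx (tsupport_fderiv_subset ℝ hx')
      simp [partialDeriv, this]
    simp [h, this]
  refine ⟨(memLp_weight_of_hasCompactSupport hh hhc).toLp h, fun K ψ hψ hcψ => ?_⟩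
  rw [integral_toLp_mul]
  simp only [integral_toLp_mul hm]
  have h1 : ∀ x, h x K * ψ x = ∑ i : Fin (k + 1), ((-1) ^ (i : ℕ) *
      (EuclideanSpace.single J (1 : ℂ)) (K.erase i)) * (partialDeriv (K i) φ x * ψ x) := by
    intro x
    have : h x K = ∑ i : Fin (k + 1), partialDeriv (K i) φ x *
        ((-1) ^ (i : ℕ) * (EuclideanSpace.single J (1 : ℂ)) (K.erase i)) := by
      simp only [h, WithLp.ofLp_sum, Finset.sum_apply, PiLp.smul_apply, smul_eq_mul]
      rw [Finset.sum_eq_single K]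
      · refine Finset.sum_congr rfl fun i _ => ?_
        rw [PiLp.single_apply, if_pos rfl]
      · intro K' _ hK'
        refine Finset.sum_eq_zero fun i _ => ?_
        rw [PiLp.single_apply, if_neg hK'.symm, mul_zero]
      · simp
    rw [this, Finset.sum_mul]
    exact Finset.sum_congr rfl fun i _ => by ring
  simp only [h1]
  have h2 : ∀ i : Fin (k + 1), Integrable fun x => partialDeriv (K i) φ x * ψ x := fun i =>
    ((continuous_partialDeriv _ hφ).mul hψ.continuous).integrable_of_hasCompactSupport
      hcψ.mul_left
  rw [integral_finsetSum _ fun i _ => (h2 i).const_mul _, ← Finset.sum_neg_distrib]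
  refine Finset.sum_congr rfl fun i _ => ?_
  rw [integral_const_mul, integral_partialDeriv_mul _ hφ hψ hc hcψ, mul_neg, mul_assoc,
    ← integral_const_mul ((EuclideanSpace.single J (1 : ℂ)) (K.erase i))]
  congr 3
  funext x
  rw [PiLp.smul_apply, smul_eq_mul]
  ring

/-- Test forms `φ dz^J` lie in the domain, so each coefficient of a form orthogonal to it integrates
to zero against every real test function. -/
lemma dense_domain_d (Φ : C(EuclideanSpace ℝ (Fin n), ℝ)) (k : ℕ) :
    Dense ((d Φ k).domain : Set (FormSpace Φ k)) := by
  rw [Submodule.dense_iff_topologicalClosure_eq_top, Submodule.topologicalClosure_eq_top_iff,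
    Submodule.eq_bot_iff]
  intro g hg
  have hae : ∀ J : Idx n k, ∀ᵐ x ∂(weight Φ), g x J = 0 := by
    intro J
    have hgJ : MemLp (fun x => g x J) 2 (weight Φ) :=
      (Lp.memLp g).continuousLinearMap_comp (EuclideanSpace.proj J : _ →L[ℂ] ℂ)
    refine ae_eq_zero_of_integral_contDiff_smul_eq_zero (hgJ.locallyIntegrable (by norm_num))
      fun φ hφ hc => ?_
    have hφ' : ContDiff ℝ ∞ fun x => (φ x : ℂ) := Complex.ofRealCLM.contDiff.comp hφ
    have hc' : HasCompactSupport fun x => (φ x : ℂ) :=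
      hc.comp_left (g := fun r : ℝ => (r : ℂ)) (by simp)
    have hm : MemLp (fun x => (φ x : ℂ) • EuclideanSpace.single J (1 : ℂ)) 2 (weight Φ) :=
      memLp_weight_of_hasCompactSupport (hφ'.continuous.smul continuous_const) hc'.smul_right
    obtain ⟨w, hw⟩ := exists_hasWeakD_single J hφ' hc' hm
    have h0 := (Submodule.mem_orthogonal _ _).1 hg _
      (LinearPMap.mem_domain_of_mem_graph (mem_graph_d.2 hw))
    rw [L2.inner_def] at h0
    rw [← h0]
    refine integral_congr_ae ?_
    filter_upwards [hm.coeFn_toLp] with x hx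
    rw [hx, inner_smul_left, EuclideanSpace.inner_single_left, Complex.conj_ofReal, map_one,
      one_mul, Complex.real_smul]
  rw [Lp.eq_zero_iff_ae_eq_zero]
  filter_upwards [ae_all_iff.2 hae] with x hx
  ext J
  simpa using hx J

lemma contDiff_partialDeriv (j : Fin n) {φ : EuclideanSpace ℝ (Fin n) → ℂ}
    (hφ : ContDiff ℝ ∞ φ) : ContDiff ℝ ∞ (partialDeriv j φ) :=
  (hφ.fderiv_right (m := ∞) (by simp)).clm_apply contDiff_const

/-- Schwarz' theorem. -/
lemma partialDeriv_comm (i j : Fin n) {φ : EuclideanSpace ℝ (Fin n) → ℂ}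
    (hφ : ContDiff ℝ ∞ φ) :
    partialDeriv i (partialDeriv j φ) = partialDeriv j (partialDeriv i φ) := by
  have hd : Differentiable ℝ (fderiv ℝ φ) :=
    (hφ.fderiv_right (m := ∞) (by simp)).differentiable (by simp)
  have h : ∀ (a b : Fin n) (x : EuclideanSpace ℝ (Fin n)), partialDeriv a (partialDeriv b φ) x =
      fderiv ℝ (fderiv ℝ φ) x (EuclideanSpace.single a 1) (EuclideanSpace.single b 1) := by
    intro a b x
    have : HasFDerivAt (partialDeriv b φ) _ x :=
      (hd x).hasFDerivAt.clm_apply (hasFDerivAt_const (EuclideanSpace.single b (1 : ℝ)) x)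
    rw [partialDeriv, this.fderiv]
    simp
  funext x
  rw [h, h]
  exact ((contDiff_infty.1 hφ 2).contDiffAt.isSymmSndFDerivAt (by simp)) _ _

lemma Idx.erase_erase (K : Idx n (k + 2)) (i : Fin (k + 2)) (j : Fin (k + 1)) :
    (K.erase (i.succAbove j)).erase (j.predAbove i) = (K.erase i).erase j := by
  ext l
  simp [Idx.erase, Fin.succAbove_succAbove_succAbove_predAbove]

/-- `d ∘ d = 0`. -/
lemma HasWeakD.hasWeakD_right {f : FormSpace Φ k} {g : FormSpace Φ (k + 1)} (h : HasWeakD f g) :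
    HasWeakD g (0 : FormSpace Φ (k + 2)) := by
  intro K φ hφ hc
  have hz : ∫ x, (0 : FormSpace Φ (k + 2)) x K * φ x = 0 := by
    simpa using integral_smul_mul (0 : ℂ) (0 : FormSpace Φ (k + 2)) K φ
  rw [hz, zero_eq_neg]
  let t : Fin (k + 2) × Fin (k + 1) → ℂ := fun p => (-1) ^ (p.1 + p.2 : ℕ) *
    ∫ x, f x ((K.erase p.1).erase p.2) *
      partialDeriv ((K.erase p.1) p.2) (partialDeriv (K p.1) φ) x
  have ht : ∀ i : Fin (k + 2), (-1 : ℂ) ^ (i : ℕ) *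
      ∫ x, g x (K.erase i) * partialDeriv (K i) φ x = -∑ j, t (i, j) := by
    intro i
    rw [h (K.erase i) _ (contDiff_partialDeriv _ hφ) (hasCompactSupport_partialDeriv _ hc),
      mul_neg, Finset.mul_sum]
    congr 1
    refine Finset.sum_congr rfl fun j _ => ?_
    rw [← mul_assoc, ← pow_add]
  rw [Finset.sum_congr rfl fun i _ => ht i, Finset.sum_neg_distrib, neg_eq_zero,
    ← Fintype.sum_prod_type]
  -- The involution removes the same two entries of `K` in the opposite order. This flips the sign,
  -- while the second derivatives agree by symmetry.
  refine Finset.sum_involution (fun p _ => (p.1.succAbove p.2, p.2.predAbove p.1)) ?_ ?_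
    (fun _ _ => Finset.mem_univ _) ?_
  · rintro ⟨i, j⟩ -
    have h1 : (K.erase (i.succAbove j)) (j.predAbove i) = K i := by
      simp [Idx.erase, Fin.succAbove_succAbove_predAbove]
    have h2 : (K.erase i) j = K (i.succAbove j) := rfl
    simp only [t, Idx.erase_erase, h1, h2, Fin.neg_one_pow_succAbove_add_predAbove]
    rw [partialDeriv_comm _ _ hφ]
    ring
  · rintro ⟨i, j⟩ - - heq
    exact Fin.succAbove_ne i j (congrArg Prod.fst heq)
  · rintro ⟨i, j⟩ -
    simp [Fin.succAbove_succAbove_predAbove, Fin.predAbove_predAbove_succAbove]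

lemma prange_d_le_pker_d (Φ : C(EuclideanSpace ℝ (Fin n), ℝ)) (k : ℕ) :
    prange (d Φ k) ≤ pker (d Φ (k + 1)) := by
  intro g hg
  obtain ⟨f, hf⟩ := mem_prange.1 hg
  exact mem_pker.2 (mem_graph_d.2 (mem_graph_d.1 hf).hasWeakD_right)

end Differential

/-! ### Range of the Laplacian off the kernel of the outgoing operator -/

section HodgeRange

variable {D E F : Type*} [NormedAddCommGroup D] [InnerProductSpace ℂ D] [CompleteSpace D]
  [NormedAddCommGroup E] [InnerProductSpace ℂ E] [CompleteSpace E]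
  [NormedAddCommGroup F] [InnerProductSpace ℂ F]

lemma prange_adjoint_comp_domRestrict {T : E →ₗ.[ℂ] F} (hc : T.IsClosed) :
    prange ((pcomp T.adjoint T).domRestrict (pker T)ᗮ) = prange (pcomp T.adjoint T) := by
  have : CompleteSpace (pker T) := (isClosed_pker hc).completeSpace_coe
  ext z
  simp only [mem_prange, mem_graph_domRestrict, mem_graph_pcomp]
  constructor
  · rintro ⟨x, -, h⟩
    exact ⟨x, h⟩
  · rintro ⟨x, y, hxy, hyz⟩
    exact ⟨(pker T)ᗮ.starProjection x, Submodule.starProjection_apply_mem _ _, y,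
      graph_starProjection (by rw [Submodule.orthogonal_orthogonal]) hxy, hyz⟩

/-- Off `Z(T)` the term `R R*` disappears, because the complement of `Z(T)` is contained in that of
`R(R)`, which is `Z(R*)`. -/
lemma prange_hodge_domRestrict [CompleteSpace F] {R : D →ₗ.[ℂ] E} {T : E →ₗ.[ℂ] F}
    (hR : Dense (R.domain : Set D)) (hc : T.IsClosed) (hRT : prange R ≤ pker T) :
    prange ((hodge R T).domRestrict (pker T)ᗮ) = prange (pcomp T.adjoint T) := by
  have hk : (pker T)ᗮ ≤ pker R.adjoint := by
    rw [pker_adjoint hR]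
    exact Submodule.orthogonal_le hRT
  rw [← prange_adjoint_comp_domRestrict hc]
  ext z
  simp only [mem_prange, mem_graph_domRestrict, mem_graph_hodge, mem_graph_pcomp]
  constructor
  · rintro ⟨x, hx, t, s, w, z', hxt, hts, hxw, hwz, rfl⟩
    obtain rfl : w = 0 := graph_unique hxw (mem_pker.1 (hk hx))
    obtain rfl : z' = 0 := graph_unique hwz R.graph.zero_mem
    exact ⟨x, hx, t, hxt, by rwa [add_zero]⟩
  · rintro ⟨x, hx, t, hxt, htz⟩
    exact ⟨x, hx, t, z, 0, 0, hxt, htz, mem_pker.1 (hk hx), R.graph.zero_mem, add_zero z⟩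

end HodgeRange

/-! ### Translation between Poincaré inequalities, norm equivalences and lower bounds -/

section Equivalences

lemma zero_lt_iff_exists_inv_sq_le {x : EReal} :
    0 < x ↔ ∃ c : ℝ, 0 < c ∧ (((c ^ 2)⁻¹ : ℝ) : EReal) ≤ x := by
  constructor
  · intro h
    obtain ⟨r, hr, hrx⟩ := EReal.lt_iff_exists_real_btwn.1 h
    have hr' : 0 < r := by exact_mod_cast hr
    -- Chosen so that `c⁻² = r`.
    refine ⟨(√r)⁻¹, by positivity, ?_⟩
    rw [inv_pow, inv_inv, Real.sq_sqrt hr'.le]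
    exact hrx.le
  · rintro ⟨c, hc, h⟩
    refine lt_of_lt_of_le ?_ h
    have : (0 : ℝ) < (c ^ 2)⁻¹ := by positivity
    exact_mod_cast this

/-- `√p` and `√(N² + p)` are equivalent iff `N²` is controlled by `p`. -/
lemma equivalentOn_sqrt_iff {α : Type*} {S : Set α} {N p : α → ℝ} (hp : ∀ v, 0 ≤ p v) :
    EquivalentOn S (fun v => √(p v)) (fun v => √(N v ^ 2 + p v)) ↔
      ∃ c : ℝ, 0 < c ∧ ∀ v ∈ S, N v ^ 2 ≤ c ^ 2 * p v := by
  constructor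
  · rintro ⟨c, _, hc, -, h⟩
    refine ⟨c⁻¹, by positivity, fun v hv => ?_⟩
    have h1 := pow_le_pow_left₀ (by positivity) (h v hv).1 2
    have h2 : 0 ≤ N v ^ 2 + p v := add_nonneg (sq_nonneg _) (hp v)
    rw [mul_pow, Real.sq_sqrt (hp v), Real.sq_sqrt h2] at h1
    rw [inv_pow, ← div_eq_inv_mul, le_div_iff₀ (by positivity)]
    nlinarith [mul_nonneg (sq_nonneg c) (hp v)]
  · rintro ⟨c, hc, h⟩
    -- The estimate gives `N² + p ≤ (c² + 1) p`; the other direction is trivial with constant `1`.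
    refine ⟨(√(c ^ 2 + 1))⁻¹, 1, by positivity, one_pos, fun v hv => ⟨?_, ?_⟩⟩
    · rw [inv_mul_le_iff₀ (by positivity), ← Real.sqrt_mul (by positivity)]
      exact Real.sqrt_le_sqrt (by linarith [h v hv])
    · rw [one_mul]
      exact Real.sqrt_le_sqrt (by linarith [sq_nonneg (N v)])

variable {n k : ℕ} {Φ : C(EuclideanSpace ℝ (Fin n), ℝ)}

lemma re_form_self (v : V Φ k) :
    RCLike.re (form v v) = ‖formDStar v‖ ^ 2 + ‖formD v‖ ^ 2 := by
  rw [form, map_add, inner_self_eq_norm_sq, inner_self_eq_norm_sq, add_comm]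

lemma poincareOn_iff_graph {M : Submodule ℂ (FormSpace Φ (k + 1))} {c : ℝ} :
    PoincareOn M c ↔ ∀ v w t, (v, w) ∈ (d Φ k).adjoint.graph → (v, t) ∈ (d Φ (k + 1)).graph →
      v ∈ M → ‖v‖ ^ 2 ≤ c ^ 2 * (‖w‖ ^ 2 + ‖t‖ ^ 2) := by
  constructor
  · intro h v w t hvw hvt hv
    obtain ⟨⟨v, h1⟩, rfl, rfl⟩ := (LinearPMap.mem_graph_iff _).1 hvw
    obtain ⟨⟨u, h2⟩, huv, rfl⟩ := (LinearPMap.mem_graph_iff _).1 hvt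
    obtain rfl : u = v := huv
    exact h ⟨u, h2, h1⟩ hv
  · intro h v hv
    exact h v _ _ (LinearPMap.mem_graph _ ⟨v.1, v.2.2⟩) (LinearPMap.mem_graph _ ⟨v.1, v.2.1⟩) hv

lemma dStarBound_iff_graph {c : ℝ} :
    DStarBound Φ k c ↔ ∀ v w, (v, w) ∈ (d Φ k).adjoint.graph → v ∈ X Φ k → ‖v‖ ≤ c * ‖w‖ := by
  constructor
  · intro h v w hvw hv
    obtain ⟨v, rfl, rfl⟩ := (LinearPMap.mem_graph_iff _).1 hvw
    exact h v hv
  · intro h v hv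
    exact h v _ (LinearPMap.mem_graph _ v) hv

lemma X_le_pker_d (Φ : C(EuclideanSpace ℝ (Fin n), ℝ)) (k : ℕ) : X Φ k ≤ pker (d Φ (k + 1)) :=
  topologicalClosure_prange_le_pker (isClosed_d Φ (k + 1)) (prange_d_le_pker_d Φ k)

lemma PoincareOn.mono {M M' : Submodule ℂ (FormSpace Φ (k + 1))} {c : ℝ} (h : PoincareOn M' c)
    (hM : M ≤ M') : PoincareOn M c :=
  fun v hv => h v (hM hv)

/-- On closed forms the Poincaré inequality only involves `d*`. -/
lemma poincareOn_iff_of_le_pker {M : Submodule ℂ (FormSpace Φ (k + 1))}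
    (hM : M ≤ pker (d Φ (k + 1))) {c : ℝ} (hc : 0 < c) :
    PoincareOn M c ↔ ∀ v w, (v, w) ∈ (d Φ k).adjoint.graph → v ∈ M → ‖v‖ ≤ c * ‖w‖ := by
  have hsq : ∀ a b : ℝ, 0 ≤ a → 0 ≤ b → (a ^ 2 ≤ c ^ 2 * b ^ 2 ↔ a ≤ c * b) := fun a b ha hb => by
    rw [← mul_pow, sq_le_sq₀ ha (by positivity)]
  rw [poincareOn_iff_graph]
  constructor
  · intro h v w hvw hv
    rw [← hsq _ _ (norm_nonneg _) (norm_nonneg _)]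
    simpa using h v w 0 hvw (mem_pker.1 (hM hv)) hv
  · intro h v w t hvw hvt hv
    obtain rfl : t = 0 := graph_unique hvt (mem_pker.1 (hM hv))
    simpa using (hsq _ _ (norm_nonneg _) (norm_nonneg _)).2 (h v w hvw hv)

lemma poincareOn_X_iff_dStarBound {c : ℝ} (hc : 0 < c) :
    PoincareOn (X Φ k) c ↔ DStarBound Φ k c := by
  rw [poincareOn_iff_of_le_pker (X_le_pker_d Φ k) hc, dStarBound_iff_graph]

lemma equivalentOn_energyNorm_iff :
    EquivalentOn (Set.univ : Set (V Φ k)) energyNorm vNorm ↔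
      ∃ c : ℝ, 0 < c ∧ PoincareOn (⊤ : Submodule ℂ (FormSpace Φ (k + 1))) c := by
  refine (equivalentOn_sqrt_iff (N := fun v : V Φ k => ‖(v : FormSpace Φ (k + 1))‖)
    (p := fun v => RCLike.re (form v v)) fun v => ?_).trans ?_
  · rw [re_form_self]
    positivity
  · simp only [re_form_self, PoincareOn, Set.mem_univ, Submodule.mem_top]

/-- Forms in `X` are closed, so there `‖d* v‖` is the energy norm and the general square root
criterion applies. -/
lemma equivalentOn_formDStar_iff :
    EquivalentOn {v : V Φ k | (v : FormSpace Φ (k + 1)) ∈ X Φ k}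
        (fun v => ‖formDStar v‖) vNorm ↔
      ∃ c : ℝ, 0 < c ∧ PoincareOn (X Φ k) c := by
  have h : EquivalentOn {v : V Φ k | (v : FormSpace Φ (k + 1)) ∈ X Φ k}
        (fun v => ‖formDStar v‖) vNorm ↔
      EquivalentOn {v : V Φ k | (v : FormSpace Φ (k + 1)) ∈ X Φ k} energyNorm vNorm := by
    have : ∀ v ∈ {v : V Φ k | (v : FormSpace Φ (k + 1)) ∈ X Φ k},
        ‖formDStar v‖ = energyNorm v := by
      intro v hv
      have h0 : formD v = 0 :=
        graph_unique (LinearPMap.mem_graph _ ⟨v.1, v.2.1⟩) (mem_pker.1 (X_le_pker_d Φ k hv))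
      rw [energyNorm, re_form_self, h0]
      simp
    refine exists_congr fun c => exists_congr fun C => and_congr_right fun _ =>
      and_congr_right fun _ => forall₂_congr fun v hv => ?_
    simp only [this v hv]
  rw [h]
  refine (equivalentOn_sqrt_iff (N := fun v : V Φ k => ‖(v : FormSpace Φ (k + 1))‖)
    (p := fun v => RCLike.re (form v v)) fun v => ?_).trans ?_
  · rw [re_form_self]
    positivity
  · simp only [re_form_self, PoincareOn, Set.mem_ofPred_eq]

lemma inv_sq_le_lowerBound_iff {c : ℝ} (hc : 0 < c) :
    (((c ^ 2)⁻¹ : ℝ) : EReal) ≤ lowerBound (A Φ (k + 1)) ↔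
      PoincareOn (⊤ : Submodule ℂ (FormSpace Φ (k + 1))) c := by
  refine (coe_le_lowerBound_hodge (dense_domain_d Φ k) (isClosed_d Φ k) (dense_domain_d Φ (k + 1))
    (isClosed_d Φ (k + 1)) (prange_d_le_pker_d Φ k)).trans ?_
  rw [poincareOn_iff_graph]
  simp only [Submodule.mem_top, true_imp_iff, inv_mul_le_iff₀ (pow_pos hc 2)]

lemma inv_sq_le_lowerBound_X_iff {c : ℝ} (hc : 0 < c) :
    (((c ^ 2)⁻¹ : ℝ) : EReal) ≤ lowerBound ((A Φ (k + 1)).domRestrict (X Φ k)) ↔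
      DStarBound Φ k c := by
  refine (coe_le_lowerBound_hodge_range (dense_domain_d Φ k) (isClosed_d Φ k)
    (isClosed_d Φ (k + 1)) (prange_d_le_pker_d Φ k)).trans ?_
  rw [dStarBound_iff_graph]
  refine forall₂_congr fun v w => imp_congr_right fun _ => imp_congr_right fun _ => ?_
  rw [inv_mul_le_iff₀ (pow_pos hc 2), ← mul_pow, sq_le_sq₀ (norm_nonneg _) (by positivity)]

lemma isClosed_prange_d_iff :
    IsClosed (prange (d Φ k) : Set (FormSpace Φ (k + 1))) ↔ ∃ c : ℝ, 0 < c ∧ DStarBound Φ k c := by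
  simp only [dStarBound_iff_graph]
  exact isClosed_prange_iff_bound_adjoint (dense_domain_d Φ k) (isClosed_d Φ k)

/-- Degree zero is separate because no differential enters there; in higher degrees the term from
the incoming differential vanishes on the restricted domain. -/
lemma prange_A_domRestrict (Φ : C(EuclideanSpace ℝ (Fin n), ℝ)) (k : ℕ) :
    prange ((A Φ k).domRestrict (pker (d Φ k))ᗮ) = prange (pcomp (d Φ k).adjoint (d Φ k)) := by
  cases k with
  | zero => exact prange_adjoint_comp_domRestrict (isClosed_d Φ 0)
  | succ k =>
    exact prange_hodge_domRestrict (dense_domain_d Φ k) (isClosed_d Φ (k + 1))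
      (prange_d_le_pker_d Φ k)

lemma exists_poincareOn_pker_iff :
    (∃ c : ℝ, 0 < c ∧ PoincareOn (pker (d Φ (k + 1))) c) ↔
      pker (d Φ (k + 1)) = prange (d Φ k) := by
  rw [← pker_eq_prange_iff (dense_domain_d Φ k) (isClosed_d Φ k) (isClosed_d Φ (k + 1))
    (prange_d_le_pker_d Φ k)]
  exact exists_congr fun c => and_congr_right fun hc => poincareOn_iff_of_le_pker le_rfl hc

end Equivalences

end WeightedForms

end

open WeightedForms in
/-- The forms have degree `k + 1 > 0`, so `d Φ (k + 1)`, `d Φ k`, `dStar Φ k`, `X Φ k`, `V Φ k`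
are `d`, the incoming differential, its adjoint, and the spaces `X`, `V` in degree `k + 1`. -/
theorem theorem4p1 (n : ℕ) (Φ : C(EuclideanSpace ℝ (Fin n), ℝ)) (hΦ : ContDiff ℝ 2 Φ)
    (hμ : ∫ x, Real.exp (-Φ x) = 1) (k : ℕ) :
    List.TFAE [
      0 < lowerBound (A Φ (k + 1)),
      EquivalentOn (Set.univ : Set (V Φ k)) energyNorm vNorm,
      ∃ c : ℝ, 0 < c ∧ PoincareOn (⊤ : Submodule ℂ (FormSpace Φ (k + 1))) c] ∧
    ((∃ c : ℝ, 0 < c ∧ PoincareOn (⊤ : Submodule ℂ (FormSpace Φ (k + 1))) c) →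
      ∃ c : ℝ, 0 < c ∧ PoincareOn (pker (d Φ (k + 1))) c) ∧
    ((∃ c : ℝ, 0 < c ∧ PoincareOn (pker (d Φ (k + 1))) c) →
      ∃ c : ℝ, 0 < c ∧ PoincareOn (X Φ k) c) ∧
    List.TFAE [
      ∃ c : ℝ, 0 < c ∧ PoincareOn (X Φ k) c,
      ∃ c : ℝ, 0 < c ∧ DStarBound Φ k c,
      IsClosed (prange (d Φ k) : Set (FormSpace Φ (k + 1))),
      IsClosed (prange ((A Φ k).domRestrict (pker (d Φ k))ᗮ) : Set (FormSpace Φ k)),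
      EquivalentOn {v : V Φ k | (v : FormSpace Φ (k + 1)) ∈ X Φ k}
        (fun v => ‖formDStar v‖) vNorm,
      0 < lowerBound ((A Φ (k + 1)).domRestrict (X Φ k))] ∧
    (∀ c : ℝ, 0 < c → PoincareOn (⊤ : Submodule ℂ (FormSpace Φ (k + 1))) c →
      (((c ^ 2)⁻¹ : ℝ) : EReal) ≤ lowerBound (A Φ (k + 1))) ∧
    (∀ c : ℝ, 0 < c →
      (PoincareOn (⊤ : Submodule ℂ (FormSpace Φ (k + 1))) c ∨
        PoincareOn (pker (d Φ (k + 1))) c ∨ PoincareOn (X Φ k) c ∨ DStarBound Φ k c) →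
      (((c ^ 2)⁻¹ : ℝ) : EReal) ≤ lowerBound ((A Φ (k + 1)).domRestrict (X Φ k))) ∧
    lowerBound (A Φ (k + 1)) =
      min (lowerBound ((A Φ (k + 1)).domRestrict (X Φ k)))
        (lowerBound ((A Φ (k + 1)).domRestrict (X Φ k)ᗮ)) ∧
    ((∃ c : ℝ, 0 < c ∧ PoincareOn (pker (d Φ (k + 1))) c) ↔
      pker (d Φ (k + 1)) = prange (d Φ k)) ∧
    ((0 < lowerBound (A Φ (k + 1)) ∨
        EquivalentOn (Set.univ : Set (V Φ k)) energyNorm vNorm ∨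
        (∃ c : ℝ, 0 < c ∧ PoincareOn (⊤ : Submodule ℂ (FormSpace Φ (k + 1))) c) ∨
        ∃ c : ℝ, 0 < c ∧ PoincareOn (pker (d Φ (k + 1))) c) →
      pker (d Φ (k + 1)) = prange (d Φ k)) := by
  have h13 : 0 < lowerBound (A Φ (k + 1)) ↔
      ∃ c : ℝ, 0 < c ∧ PoincareOn (⊤ : Submodule ℂ (FormSpace Φ (k + 1))) c :=
    zero_lt_iff_exists_inv_sq_le.trans
      (exists_congr fun c => and_congr_right fun hc => inv_sq_le_lowerBound_iff hc)
  have h34 : (∃ c : ℝ, 0 < c ∧ PoincareOn (⊤ : Submodule ℂ (FormSpace Φ (k + 1))) c) →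
      ∃ c : ℝ, 0 < c ∧ PoincareOn (pker (d Φ (k + 1))) c :=
    fun ⟨c, hc, h⟩ => ⟨c, hc, h.mono le_top⟩
  have h56 : (∃ c : ℝ, 0 < c ∧ PoincareOn (X Φ k) c) ↔ ∃ c : ℝ, 0 < c ∧ DStarBound Φ k c :=
    exists_congr fun c => and_congr_right fun hc => poincareOn_X_iff_dStarBound hc
  have h8 : IsClosed (prange (d Φ k) : Set (FormSpace Φ (k + 1))) ↔
      IsClosed (prange ((A Φ k).domRestrict (pker (d Φ k))ᗮ) : Set (FormSpace Φ k)) := by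
    rw [prange_A_domRestrict]
    exact isClosed_prange_iff_isClosed_prange_adjoint_comp (dense_domain_d Φ k) (isClosed_d Φ k)
  have h10 : 0 < lowerBound ((A Φ (k + 1)).domRestrict (X Φ k)) ↔
      ∃ c : ℝ, 0 < c ∧ DStarBound Φ k c :=
    zero_lt_iff_exists_inv_sq_le.trans
      (exists_congr fun c => and_congr_right fun hc => inv_sq_le_lowerBound_X_iff hc)
  refine ⟨?_, h34, fun ⟨c, hc, h⟩ => ⟨c, hc, h.mono (X_le_pker_d Φ k)⟩, ?_,
    fun c hc h => (inv_sq_le_lowerBound_iff hc).2 h, ?_, ?_, exists_poincareOn_pker_iff, ?_⟩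
  · tfae_have 1 ↔ 3 := h13
    tfae_have 2 ↔ 3 := equivalentOn_energyNorm_iff
    tfae_finish
  · tfae_have 1 ↔ 2 := h56
    tfae_have 3 ↔ 2 := isClosed_prange_d_iff
    tfae_have 3 ↔ 4 := h8
    tfae_have 5 ↔ 1 := equivalentOn_formDStar_iff
    tfae_have 6 ↔ 2 := h10
    tfae_finish
  · intro c hc h
    rw [inv_sq_le_lowerBound_X_iff hc]
    rcases h with h | h | h | h
    · exact (poincareOn_X_iff_dStarBound hc).1 (h.mono le_top)
    · exact (poincareOn_X_iff_dStarBound hc).1 (h.mono (X_le_pker_d Φ k))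
    · exact (poincareOn_X_iff_dStarBound hc).1 h
    · exact h
  · exact lowerBound_hodge (dense_domain_d Φ k) (isClosed_d Φ k) (dense_domain_d Φ (k + 1))
      (isClosed_d Φ (k + 1)) (prange_d_le_pker_d Φ k)
  · rintro (h | h | h | h) <;> rw [← exists_poincareOn_pker_iff]
    · exact h34 (h13.1 h)
    · exact h34 (equivalentOn_energyNorm_iff.1 h)
    · exact h34 h
    · exact h
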